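/- **Lemma ($p=23$).** Two ternary codes are called equivalent if a monomial transformation (a permutation of the coordinates followed by multiplication of each coordinate by $\pm1$) maps one onto the other, and $\mathrm{Mon}(C)$ denotes the group of all monomial transformations $\sigma$ with $\sigma(C)=C$. Let $P_{48}$ be the Pless symmetry code of length $48$, that is, the code with generator matrix $(I_{24}\mid S)$, where $S$ is indexed by $\{\infty\}\cup\mathbb{F}_{23}$, $S_{\infty\infty}=0$, $S_{\infty j}=1$, $S_{i\infty}=\chi(-1)$, $S_{ij}=\chi(j-i)$ and $\chi$ is the quadratic character of $\mathbb{F}_{23}$. Let $Q_{48}$ be the extended ternary quadratic residue code of length $48$ (formed with any primitive $47$th root of unity $\alpha$ over $\mathbb{F}_3$). Let $\zeta\in L:=\mathbb{F}_{3^{11}}$ be a primitive $23$rd root of unity, and let $\mathrm{Tr}:L\to\mathbb{F}_3$ be the trace. Divide $48$ coordinates into two blocks of $23$ and two further coordinates, and let $\sigma_0$ be the coordinate permutation that shifts each block cyclically by one step, $(\sigma_0c)_{b,i}=c_{b,i-1}$ for $i\in\mathbb{Z}/23$, and fixes the last two coordinates. Put $$F=\langle(1^{23},0^{23},1,0),\,(0^{23},1^{23},0,1)\rangle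 ,$$ and for $s\in L$ and $\xi\in\{\zeta,\zeta^{-1}\}$ let $$E_\xi(s)=\bigl\{\bigl((\mathrm{Tr}(a\,\xi^{-i}))_{0\le i<23},\,(\mathrm{Tr}(sa\,\xi^{-i}))_{0\le i<23},\,0,\,0\bigr) : a\in L\bigr\},$$ which is the one-dimensional code over $L$ of length $2$ with generator matrix $(1,s)$, where $L$ is identified with an irreducible cyclic ternary code of length $23$ via $a\mapsto(\mathrm{Tr}(a\xi^{-i}))_i$. For $t\in L^*$ put $C_t=F+E_\zeta(t)+E_{\zeta^{-1}}(-t^{-1})$. (i) Let $C=C^\perp\le\mathbb{F}_3^{48}$ be an extremal self-dual code (so $d(C)=15$) and let $\sigma\in\mathrm{Mon}(C)$ have order $23$. Then $C$ is equivalent to $P_{48}$ or to $Q_{48}$. Moreover there is a monomial transformation $\tau$ with $\tau\sigma\tau^{-1}=\sigma_0$ such that the code $C'=\tau(C)$ has fixed code $\{c\in C' : \sigma_0c=c\}=F$, and there is $t\in L^*$ such that the components of $C'$ annihilated by $g(\sigma_0)$ and by $h(\sigma_0)$, where $g$ and $h$ are the minimal polynomials of $\zeta$ and $\zeta^{-1}$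 over $\mathbb{F}_3$, are $E_\zeta(t)$ and $E_{\zeta^{-1}}(-t^{-1})$ respectively, and $C'=C_t$. (ii) Let $t\in L^*$. If $\eta\in L$ satisfies $\eta^{23}=1$, then $C_{\eta t}$ is equivalent to $C_t$. If $C_t$ has minimum distance at least $15$, then $C_t$ is equivalent to $P_{48}$ or to $Q_{48}$. -/

import Mathlib

/-! Linear codes of length `n` over a field `F` are subspaces of `ι → F`, where `ι` is a set of `n`
coordinates. -/

namespace TernaryCodes

section General

variable {F : Type*} [Field F] {ι κ : Type*}

/-- A monomial transformation from the coordinate space on `ι` to the one on `κ`: a relabelling of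
the coordinates followed by multiplication of each coordinate by a nonzero scalar. For `ι = κ`
these are the elements of `Fˣ ≀ Sym ι`. -/
def IsMonomial (f : (ι → F) ≃ₗ[F] (κ → F)) : Prop :=
  ∃ (e : ι ≃ κ) (u : κ → Fˣ), ∀ (x : ι → F) (k : κ), f x k = (u k : F) * x (e.symm k)

/-- Monomial equivalence of codes. -/
def CodeEquiv (C : Submodule F (ι → F)) (D : Submodule F (κ → F)) : Prop :=
  ∃ f : (ι → F) ≃ₗ[F] (κ → F), IsMonomial f ∧ C.map f.toLinearMap = D

/-- `Mon(C)`, the full monomial automorphism group of the code `C`. -/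
def Mon (C : Submodule F (ι → F)) : Subgroup ((ι → F) ≃ₗ[F] (ι → F)) where
  carrier := {f | IsMonomial f ∧ C.map f.toLinearMap = C}
  one_mem' := by
    refine ⟨⟨Equiv.refl ι, fun _ => 1, fun x k => by simp⟩, ?_⟩
    exact Submodule.map_id C
  mul_mem' := by
    rintro f g ⟨⟨e, u, h⟩, hf⟩ ⟨⟨e', u', h'⟩, hg⟩
    refine ⟨⟨e'.trans e, fun k => u k * u' (e.symm k), fun x k => ?_⟩, ?_⟩
    · rw [LinearEquiv.mul_apply, h, h']
      simp [mul_assoc]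
    · have : (f * g).toLinearMap = f.toLinearMap ∘ₗ g.toLinearMap := rfl
      rw [this, Submodule.map_comp, hg, hf]
  inv_mem' := by
    rintro f ⟨⟨e, u, h⟩, hf⟩
    refine ⟨⟨e.symm, fun k => (u (e k))⁻¹, fun x k => ?_⟩, ?_⟩
    · have h1 : f (f⁻¹ x) = x := f.apply_symm_apply x
      have h2 := h (f⁻¹ x) (e k)
      rw [h1, e.symm_apply_apply] at h2
      simp [h2]
    · ext x
      constructor
      · rintro ⟨y, hy, rfl⟩
        have hy' : y ∈ C.map f.toLinearMap := by rw [hf]; exact hy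
        obtain ⟨z, hz, rfl⟩ := hy'
        have h1 : f⁻¹ (f z) = z := f.symm_apply_apply z
        simpa [h1] using hz
      · intro hx
        refine ⟨f x, ?_, f.symm_apply_apply x⟩
        rw [← hf]
        exact ⟨x, hx, rfl⟩

/-- The dual code `C^⊥` with respect to the standard bilinear form. -/
def dualCode [Fintype ι] (C : Submodule F (ι → F)) : Submodule F (ι → F) where
  carrier := {x | ∀ c ∈ C, ∑ i, x i * c i = 0}
  zero_mem' := by intro c _; simp
  add_mem' := by
    intro x y hx hy c hc
    simp [add_mul, Finset.sum_add_distrib, hx c hc, hy c hc]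
  smul_mem' := by
    intro a x hx c hc
    simp [mul_assoc, ← Finset.mul_sum, hx c hc]

/-- The minimum distance `d(C) = min {wt(c) | 0 ≠ c ∈ C}`. -/
noncomputable def minDist [Fintype ι] [DecidableEq F] (C : Submodule F (ι → F)) : ℕ :=
  sInf {w | ∃ c ∈ C, c ≠ 0 ∧ hammingNorm c = w}

/-- The fixed code `C(σ)`. -/
def fixedCode (σ : (ι → F) ≃ₗ[F] (ι → F)) (C : Submodule F (ι → F)) : Submodule F (ι → F) :=
  C ⊓ LinearMap.eqLocus σ.toLinearMap LinearMap.id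

/-- For a code `C` invariant under `σ`, `σ ^ p = 1` with `p` not divisible by the characteristic,
and `q` an irreducible factor of `X ^ p - 1`: the component `C e` of `C`, where `e` is the
primitive idempotent of `F[X] / (X ^ p - 1) = F⟨σ⟩` that belongs to `q`. It consists of the
codewords annihilated by `q(σ)`. -/
noncomputable def eigenComponent (σ : (ι → F) ≃ₗ[F] (ι → F)) (C : Submodule F (ι → F))
    (q : Polynomial F) : Submodule F (ι → F) :=
  C ⊓ LinearMap.ker (Polynomial.aeval (σ.toLinearMap : Module.End F (ι → F)) q)

end General

/-- Extremal self-dual ternary codes: `C = C^⊥` and `d(C) = 3 ⌊n / 12⌋ + 3`. -/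
def IsExtremalSelfDual {ι : Type*} [Fintype ι] (C : Submodule (ZMod 3) (ι → ZMod 3)) : Prop :=
  C = dualCode C ∧ minDist C = 3 * (Fintype.card ι / 12) + 3

/-! ### The two known codes -/

/-- The bordered Paley matrix `S` of the Pless symmetry code, with rows and columns indexed by
`{∞} ∪ ZMod q`; here `χ` is the quadratic character: `S(∞, ∞) = 0`, `S(∞, j) = 1`,
`S(i, ∞) = χ(-1)`, `S(i, j) = χ(j - i)`. -/
def plessMatrix (q : ℕ) [Fact q.Prime] : Option (ZMod q) → Option (ZMod q) → ZMod 3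
  | none, none => 0
  | none, some _ => 1
  | some _, none => ((quadraticChar (ZMod q) (-1) : ℤ) : ZMod 3)
  | some i, some j => ((quadraticChar (ZMod q) (j - i) : ℤ) : ZMod 3)

/-- The Pless symmetry code of length `2 q + 2`, spanned by the rows of the matrix `(I | S)`. -/
def plessCode (q : ℕ) [Fact q.Prime] :
    Submodule (ZMod 3) (Option (ZMod q) ⊕ Option (ZMod q) → ZMod 3) :=
  Submodule.span (ZMod 3)
    (Set.range fun i : Option (ZMod q) => Sum.elim (Pi.single i 1) (plessMatrix q i))

instance fact_prime_23 : Fact (Nat.Prime 23) := ⟨by norm_num⟩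

instance fact_prime_47 : Fact (Nat.Prime 47) := ⟨by norm_num⟩

/-- The Pless code `P₄₈`. -/
def P48 : Submodule (ZMod 3) (Option (ZMod 23) ⊕ Option (ZMod 23) → ZMod 3) :=
  plessCode 23

/-- The extended ternary quadratic residue code of length `p + 1`, for a primitive `p`-th root of
unity `α` in an algebraic closure of `𝔽₃`. The coordinates are `ZMod p` and `∞ = none`. The words
of the quadratic residue code are the `(c_i)` for which `∑ c_i X ^ i` vanishes at `α ^ r` for all
nonzero squares `r` modulo `p`, and the extension adds the overall parity check `c_∞ = - ∑ c_i`. -/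
def extendedQRCode (p : ℕ) [Fact p.Prime] (α : AlgebraicClosure (ZMod 3)) :
    Submodule (ZMod 3) (Option (ZMod p) → ZMod 3) where
  carrier := {c |
    (∀ r : ZMod p, r ≠ 0 → IsSquare r →
      ∑ i : ZMod p, algebraMap (ZMod 3) (AlgebraicClosure (ZMod 3)) (c (some i)) *
        (α ^ r.val) ^ i.val = 0) ∧
    c none = - ∑ i : ZMod p, c (some i)}
  zero_mem' := by simp
  add_mem' := by
    rintro x y ⟨hx, hx'⟩ ⟨hy, hy'⟩
    refine ⟨fun r hr hs => ?_, ?_⟩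
    · simp only [Pi.add_apply, map_add, add_mul, Finset.sum_add_distrib, hx r hr hs, hy r hr hs,
        add_zero]
    · simp only [Pi.add_apply, hx', hy', Finset.sum_add_distrib, neg_add]
  smul_mem' := by
    rintro a x ⟨hx, hx'⟩
    refine ⟨fun r hr hs => ?_, ?_⟩
    · simp only [Pi.smul_apply, smul_eq_mul, map_mul, mul_assoc, ← Finset.mul_sum, hx r hr hs,
        mul_zero]
    · simp only [Pi.smul_apply, smul_eq_mul, hx', mul_neg, Finset.mul_sum]

/-- The extended quadratic residue code `Q₄₈`. -/
def Q48 (α : AlgebraicClosure (ZMod 3)) : Submodule (ZMod 3) (Option (ZMod 47) → ZMod 3) :=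
  extendedQRCode 47 α

/-! ### Codes of length 48 with a permutation automorphism of cycle type `(2, 2)` -/

/-- 48 coordinates: two blocks of 23 and two further ones. -/
abbrev Coord : Type := (Fin 2 × ZMod 23) ⊕ Fin 2

/-- The coordinate permutation that shifts both blocks cyclically by one step and fixes the last
two coordinates: `(σ c)_{b, i} = c_{b, i - 1}`. -/
def blockShift : (Coord → ZMod 3) ≃ₗ[ZMod 3] (Coord → ZMod 3) :=
  LinearEquiv.funCongrLeft (ZMod 3) (ZMod 3)
    (Equiv.sumCongr (Equiv.prodCongr (Equiv.refl (Fin 2)) (Equiv.subRight (1 : ZMod 23)))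
      (Equiv.refl (Fin 2)))

/-- The code spanned by `(1²³, 0²³, 1, 0)` and `(0²³, 1²³, 0, 1)`. -/
def standardFixedCode : Submodule (ZMod 3) (Coord → ZMod 3) :=
  Submodule.span (ZMod 3) (Set.range fun b : Fin 2 =>
    (Sum.elim (fun k => if k.1 = b then 1 else 0) (fun j => if j = b then 1 else 0) :
      Coord → ZMod 3))

/-- For a primitive 23rd root of unity `ζ`, the map `a ↦ (Tr(a ζ ^ (-i)))_i` identifies the field
with `3 ^ 11` elements with an irreducible cyclic code of length 23, on which the cyclic shift
acts as multiplication by `ζ`. This is the resulting identification of words of length two over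
this field with ternary words that are zero on the last two coordinates. -/
noncomputable def traceWord (ζ : GaloisField 3 11) :
    (Fin 2 → GaloisField 3 11) →ₗ[ZMod 3] (Coord → ZMod 3) where
  toFun a := Sum.elim
    (fun k => Algebra.trace (ZMod 3) (GaloisField 3 11) (a k.1 * (ζ⁻¹) ^ k.2.val)) (fun _ => 0)
  map_add' a b := by
    ext k
    rcases k with k | k <;> simp [add_mul]
  map_smul' s a := by
    ext k
    rcases k with k | k <;> simp

/-- The ternary code obtained in this way from the code of length 2 and dimension 1 over the field
with `3 ^ 11` elements that has the generator matrix `(1, s)`. -/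
noncomputable def eigenCode (ζ s : GaloisField 3 11) : Submodule (ZMod 3) (Coord → ZMod 3) :=
  ((Submodule.span (GaloisField 3 11) {![1, s]}).restrictScalars (ZMod 3)).map (traceWord ζ)

/-- The code with the standard fixed code and with the two other components given by `(1, t)` and
`(1, -t⁻¹)`. -/
noncomputable def codeOfParameter (ζ t : GaloisField 3 11) :
    Submodule (ZMod 3) (Coord → ZMod 3) :=
  standardFixedCode ⊔ eigenCode ζ t ⊔ eigenCode ζ⁻¹ (-t⁻¹)

end TernaryCodes

/-! Since 3 has order 11 modulo 23 and -1 is not a power of 3, the group algebra of a cyclic group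
of order 23 over 𝔽₃ is 𝔽₃ ⊕ L ⊕ L. A word on two 23-cycles and two fixed points is therefore
governed by its fixed part and by the Fourier coefficients of its blocks at ζ and ζ⁻¹.

For (i), σ has two 23-cycles: with only one, the fixed code would have dimension at least 13 and
contain a nonzero word of weight at most 14 (`card_support_ne`). Signs along the cycles are absorbed
into the coordinates (`exists_isMonomial_conj`). A nonzero vector of L² in a component has no zero
entry, for otherwise one of its L-multiples would be a word of weight at most 13
(`eq_zero_of_traceWord_mem`). As 24 = 2 + 11 + 11, the components are then lines spanned by (1, t)
and (1, t'), and self-orthogonality forces tt' = -1 (`exists_parameter`). The fixed code is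
described by an orthogonal 2×2 matrix over 𝔽₃; such a matrix is monomial, so the fixed code can be
normalised to F (`exists_isMonomial_standardFixedCode_le`).

For (ii), up to equivalence C_t is unchanged when t is multiplied by a 46th root of unity, inverted
or cubed. Now |L*| = 46 · 3851 with 3851 prime, 2 generates the units modulo 3851, and 2^175 ≡ -3.
With β of order 3851, it remains to treat t = 1 and t = β^(2^m) for 0 ≤ m < 175. The code for t = 1
is P₄₈ (`codeEquiv_P48`), the one for m = 0 is Q₄₈ (`codeEquiv_Q48`), and each of the other 174
contains an explicit nonzero word of weight at most 14 (`exists_low_weight`). -/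

namespace TernaryCodes

/-- The field with `3 ^ 11` elements. -/
abbrev L : Type := GaloisField 3 11

/-! ### Fourier analysis of ternary words of length 23. -/

section Fourier

theorem finrank_L : Module.finrank (ZMod 3) L = 11 := GaloisField.finrank 3 (by norm_num)

theorem natCard_L : Nat.card L = 3 ^ 11 := GaloisField.card 3 11 (by norm_num)

theorem pow_val_add {M : Type*} [Monoid M] {n : ℕ} [NeZero n] {ξ : M} (h : ξ ^ n = 1)
    (i j : ZMod n) :
    ξ ^ (i + j).val = ξ ^ i.val * ξ ^ j.val := by
  rw [ZMod.val_add, ← pow_add, ← pow_eq_pow_mod _ h]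

theorem inv_pow_val {K : Type*} [Field K] {n : ℕ} [NeZero n] {ξ : K} (h : ξ ^ n = 1)
    (i : ZMod n) :
    ξ⁻¹ ^ i.val = ξ ^ (-i).val := by
  have h1 : ξ ^ (-i).val * ξ ^ i.val = 1 := by
    rw [← pow_val_add h]; simp
  rw [inv_pow, eq_comm]
  exact eq_inv_of_mul_eq_one_left h1

/-- The Fourier coefficient `∑ u i * ξ ^ i` of a word of length 23. -/
noncomputable def fourier (ξ : L) : (ZMod 23 → ZMod 3) →ₗ[ZMod 3] L where
  toFun u := ∑ i, algebraMap (ZMod 3) L (u i) * ξ ^ i.val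
  map_add' u v := by simp [add_mul, Finset.sum_add_distrib]
  map_smul' a u := by simp [Finset.mul_sum, Algebra.smul_def, mul_assoc]

theorem fourier_apply (ξ : L) (u : ZMod 23 → ZMod 3) :
    fourier ξ u = ∑ i, algebraMap (ZMod 3) L (u i) * ξ ^ i.val := rfl

theorem three_eq_zero : (3 : L) = 0 := by
  have := CharP.cast_eq_zero L 3
  exact_mod_cast this

theorem twentythree_eq : (23 : L) = -1 := by
  linear_combination 8 * three_eq_zero

theorem algebraMap_trace (a : L) :
    algebraMap (ZMod 3) L (Algebra.trace (ZMod 3) L a) = ∑ k ∈ Finset.range 11, a ^ 3 ^ k := by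
  rw [FiniteField.algebraMap_trace_eq_sum_pow, finrank_L]
  simp

theorem sum_pow_val {K : Type*} [Field K] {ξ : K} (hξ : IsPrimitiveRoot ξ 23) (n : ℕ) :
    ∑ i : ZMod 23, (ξ ^ n) ^ i.val = if 23 ∣ n then 23 else 0 := by
  have key : ∑ i : ZMod 23, (ξ ^ n) ^ i.val = ∑ i ∈ Finset.range 23, (ξ ^ n) ^ i :=
    Fin.sum_univ_eq_sum_range (fun i => (ξ ^ n) ^ i) 23
  rw [key]
  split_ifs with h
  · rw [(hξ.pow_eq_one_iff_dvd n).2 h]; simp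
  · have h1 : ξ ^ n ≠ 1 := fun h1 => h ((hξ.pow_eq_one_iff_dvd n).1 h1)
    rw [geom_sum_eq h1, ← pow_mul, mul_comm, pow_mul, hξ.pow_eq_one]
    simp

/-- Expanding the trace into conjugates, the k-th term is a^(3^k) times the sum of all ξ^((1 -
3^k)i). Only k = 0 survives, and it contributes 23a = -a. -/
theorem fourier_trace_self {ξ : L} (hξ : IsPrimitiveRoot ξ 23) (a : L) :
    fourier ξ (fun i => Algebra.trace (ZMod 3) L (a * ξ⁻¹ ^ i.val)) = -a := by
  have h0 : ξ ≠ 0 := hξ.ne_zero (by norm_num)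
  simp only [fourier_apply, algebraMap_trace, Finset.sum_mul]
  rw [Finset.sum_comm]
  have h1 : ∀ k ∈ Finset.range 11, ∑ i : ZMod 23, (a * ξ⁻¹ ^ i.val) ^ 3 ^ k * ξ ^ i.val =
      if k = 0 then -a else 0 := by
    intro k hk
    have h2 : ∀ i : ZMod 23, (a * ξ⁻¹ ^ i.val) ^ 3 ^ k * ξ ^ i.val =
        a ^ 3 ^ k * (ξ⁻¹ ^ (3 ^ k + 22)) ^ i.val := by
      intro i
      have h3 : ξ ^ i.val = (ξ⁻¹ ^ 22) ^ i.val := by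
        congr 1
        rw [inv_pow]
        exact eq_inv_of_mul_eq_one_left (by rw [← pow_succ', hξ.pow_eq_one])
      rw [h3, mul_pow]
      ring
    simp only [h2, ← Finset.mul_sum, sum_pow_val hξ.inv]
    fin_cases hk <;> simp [twentythree_eq]
  rw [Finset.sum_congr rfl h1]
  simp

/-- Every conjugate now contributes a full sum of powers of ξ^(3^k + 1), which vanishes because -1
is not a power of 3 modulo 23. -/
theorem fourier_trace_inv {ξ : L} (hξ : IsPrimitiveRoot ξ 23) (a : L) :
    fourier ξ (fun i => Algebra.trace (ZMod 3) L (a * ξ ^ i.val)) = 0 := by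
  simp only [fourier_apply, algebraMap_trace, Finset.sum_mul]
  rw [Finset.sum_comm]
  refine Finset.sum_eq_zero fun k hk => ?_
  have h2 : ∀ i : ZMod 23, (a * ξ ^ i.val) ^ 3 ^ k * ξ ^ i.val =
      a ^ 3 ^ k * (ξ ^ (3 ^ k + 1)) ^ i.val := by
    intro i
    rw [mul_pow]
    ring
  simp only [h2, ← Finset.mul_sum, sum_pow_val hξ]
  fin_cases hk <;> simp

theorem sum_trace {ξ : L} (hξ : IsPrimitiveRoot ξ 23) (a : L) :
    ∑ i : ZMod 23, Algebra.trace (ZMod 3) L (a * ξ ^ i.val) = 0 := by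
  rw [← map_sum, ← Finset.mul_sum]
  have := sum_pow_val hξ 1
  simp only [pow_one] at this
  rw [this]
  simp

/-- The exponents modulo 23 split into 0, the eleven powers of 3 and their negatives, so the left
side is the full sum of the powers of ξ^i. This is the Fourier kernel behind inversion. -/
theorem one_add_trace_add_trace {ξ : L} (hξ : IsPrimitiveRoot ξ 23) (i : ZMod 23) :
    1 + Algebra.trace (ZMod 3) L (ξ ^ i.val) + Algebra.trace (ZMod 3) L (ξ⁻¹ ^ i.val) =
      if i = 0 then -1 else 0 := by
  apply (algebraMap (ZMod 3) L).injective
  have h0 : ξ ≠ 0 := hξ.ne_zero (by norm_num)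
  have h1 : ∀ n : ℕ, (ξ ^ i.val) ^ n = (ξ ^ i.val) ^ (n % 23) := fun n => by
    rw [← pow_eq_pow_mod]
    rw [← pow_mul, mul_comm, pow_mul, hξ.pow_eq_one, one_pow]
  have h2 : ξ⁻¹ ^ i.val = (ξ ^ i.val) ^ 22 := by
    rw [inv_pow, eq_comm]
    exact eq_inv_of_mul_eq_one_left (by rw [← pow_succ, h1]; simp)
  have h3 := sum_pow_val hξ i.val
  have key : ∑ j : ZMod 23, (ξ ^ i.val) ^ j.val = ∑ j ∈ Finset.range 23, (ξ ^ i.val) ^ j :=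
    Fin.sum_univ_eq_sum_range (fun j => (ξ ^ i.val) ^ j) 23
  have h4 : 23 ∣ i.val ↔ i = 0 := by
    rw [← ZMod.natCast_eq_zero_iff]; simp
  rw [map_add, map_add, algebraMap_trace, algebraMap_trace, h2]
  have h5 : ∀ k, ((ξ ^ i.val) ^ 22) ^ 3 ^ k = (ξ ^ i.val) ^ (22 * 3 ^ k % 23) := fun k => by
    rw [← pow_mul, h1]
  simp only [h5]
  have h6 : ∑ k ∈ Finset.range 11, (ξ ^ i.val) ^ 3 ^ k =
    ∑ k ∈ Finset.range 11, (ξ ^ i.val) ^ (3 ^ k % 23) := Finset.sum_congr rfl fun k _ => h1 _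
  rw [h6]
  simp only [key, h4] at h3
  have h7 : algebraMap (ZMod 3) L (if i = 0 then -1 else 0) = if i = 0 then 23 else 0 := by
    rw [twentythree_eq]; split_ifs <;> simp
  rw [h7, ← h3]
  simp only [Finset.sum_range_succ, Finset.sum_range_zero]
  norm_num
  ring

theorem fourier_inversion {ξ : L} (hξ : IsPrimitiveRoot ξ 23) (u : ZMod 23 → ZMod 3)
    (i : ZMod 23) :
    u i = -(∑ j, u j) - Algebra.trace (ZMod 3) L (fourier ξ u * ξ⁻¹ ^ i.val) -
      Algebra.trace (ZMod 3) L (fourier ξ⁻¹ u * ξ ^ i.val) := by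
  have key : ∀ ξ : L, IsPrimitiveRoot ξ 23 → Algebra.trace (ZMod 3) L (fourier ξ u * ξ⁻¹ ^ i.val) =
      ∑ j, u j * Algebra.trace (ZMod 3) L (ξ ^ (j - i).val) := by
    intro ξ hξ
    rw [fourier_apply, Finset.sum_mul, map_sum]
    refine Finset.sum_congr rfl fun j _ => ?_
    rw [inv_pow_val hξ.pow_eq_one, mul_assoc, ← pow_val_add hξ.pow_eq_one, ← Algebra.smul_def,
      map_smul, smul_eq_mul, sub_eq_add_neg]
  have k2 := key ξ⁻¹ hξ.inv
  rw [inv_inv] at k2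
  rw [key ξ hξ, k2]
  have : ∀ j, u j * (1 + Algebra.trace (ZMod 3) L (ξ ^ (j - i).val) +
      Algebra.trace (ZMod 3) L (ξ⁻¹ ^ (j - i).val)) = if j = i then - u i else 0 := by
    intro j
    simp only [one_add_trace_add_trace hξ, sub_eq_zero]
    split_ifs with h <;> simp [h]
  have h := Finset.sum_congr rfl fun j (_ : j ∈ Finset.univ) => this j
  simp only [mul_add, Finset.sum_add_distrib, mul_one, Finset.sum_ite_eq', Finset.mem_univ,
    if_true] at h
  linear_combination h

end Fourier

/-! ### Parity-check description of C_t. -/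

section Parity

/-- One of the two blocks of 23 coordinates of a word. -/
def block (b : Fin 2) : (Coord → ZMod 3) →ₗ[ZMod 3] (ZMod 23 → ZMod 3) :=
  LinearMap.funLeft (ZMod 3) (ZMod 3) fun i => Sum.inl (b, i)

@[simp]
theorem block_apply (b : Fin 2) (c : Coord → ZMod 3) (i : ZMod 23) :
    block b c i = c (Sum.inl (b, i)) := rfl

@[simp]
theorem traceWord_inl (ξ : L) (a : Fin 2 → L) (b : Fin 2) (i : ZMod 23) :
    traceWord ξ a (Sum.inl (b, i)) = Algebra.trace (ZMod 3) L (a b * ξ⁻¹ ^ i.val) := rfl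

@[simp]
theorem traceWord_inr (ξ : L) (a : Fin 2 → L) (b : Fin 2) : traceWord ξ a (Sum.inr b) = 0 := rfl

theorem mem_standardFixedCode {c : Coord → ZMod 3} :
    c ∈ standardFixedCode ↔ ∀ b i, c (Sum.inl (b, i)) = c (Sum.inr b) := by
  constructor
  · intro h
    induction h using Submodule.span_induction with
    | mem x hx => obtain ⟨b, rfl⟩ := hx; simp
    | zero => simp
    | add x y _ _ hx hy => intro b i; simp [hx, hy]
    | smul a x _ hx => intro b i; simp [hx]
  · intro h
    have : c = ∑ b : Fin 2, c (Sum.inr b) •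
        (Sum.elim (fun k => if k.1 = b then 1 else 0) (fun j => if j = b then 1 else 0) :
          Coord → ZMod 3) := by
      ext (⟨b, i⟩ | b)
      · simp [h, Finset.sum_apply]
      · simp [Finset.sum_apply]
    rw [this]
    exact Submodule.sum_mem _ fun b _ => Submodule.smul_mem _ _ (Submodule.subset_span ⟨b, rfl⟩)

theorem mem_eigenCode {ξ s : L} {c : Coord → ZMod 3} :
    c ∈ eigenCode ξ s ↔ ∃ a : L, traceWord ξ ![a, s * a] = c := by
  unfold eigenCode
  simp only [Submodule.mem_map, Submodule.restrictScalars_mem, Submodule.mem_span_singleton,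
    exists_exists_eq_and]
  refine exists_congr fun a => ?_
  rw [show a • ![1, s] = ![a, s * a] by ext b; fin_cases b <;> simp [mul_comm]]

theorem fourier_block_traceWord {ξ : L} (hξ : IsPrimitiveRoot ξ 23) (a : Fin 2 → L) (b : Fin 2) :
    fourier ξ (block b (traceWord ξ a)) = -a b :=
  fourier_trace_self hξ (a b)

theorem fourier_inv_block_traceWord {ξ : L} (hξ : IsPrimitiveRoot ξ 23) (a : Fin 2 → L)
    (b : Fin 2) : fourier ξ⁻¹ (block b (traceWord ξ a)) = 0 :=
  fourier_trace_inv hξ.inv (a b)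

theorem fourier_block_traceWord_inv {ξ : L} (hξ : IsPrimitiveRoot ξ 23) (a : Fin 2 → L)
    (b : Fin 2) : fourier ξ (block b (traceWord ξ⁻¹ a)) = 0 := by
  simpa using fourier_inv_block_traceWord hξ.inv a b

theorem sum_block_traceWord {ξ : L} (hξ : IsPrimitiveRoot ξ 23) (a : Fin 2 → L)
    (b : Fin 2) : ∑ i, block b (traceWord ξ a) i = 0 :=
  sum_trace hξ.inv (a b)

theorem fourier_block_of_mem_standardFixedCode {ξ : L} (hξ : IsPrimitiveRoot ξ 23)
    {c : Coord → ZMod 3} (hc : c ∈ standardFixedCode) (b : Fin 2) :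
    fourier ξ (block b c) = 0 := by
  rw [mem_standardFixedCode] at hc
  simp only [fourier_apply, block_apply, hc, ← Finset.mul_sum]
  have := sum_pow_val hξ 1
  simp only [pow_one] at this
  rw [this]
  simp

/-- The component of a word that is constant on the blocks. -/
def constantPart (c : Coord → ZMod 3) : Coord → ZMod 3 :=
  Sum.elim (fun k => c (Sum.inr k.1)) fun b => c (Sum.inr b)

theorem constantPart_mem (c : Coord → ZMod 3) : constantPart c ∈ standardFixedCode := by
  rw [mem_standardFixedCode]; intro b i; rfl

theorem eq_constantPart_add_traceWord {ξ : L} (hξ : IsPrimitiveRoot ξ 23) {c : Coord → ZMod 3}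
    (hc : ∀ b, c (Sum.inr b) = -∑ i, block b c i) :
    c = constantPart c + traceWord ξ (fun b => -fourier ξ (block b c)) +
      traceWord ξ⁻¹ (fun b => -fourier ξ⁻¹ (block b c)) := by
  ext (⟨b, i⟩ | b)
  · have h := fourier_inversion hξ (block b c) i
    rw [← hc] at h
    simp only [block_apply] at h
    rw [h]
    simp [constantPart, sub_eq_add_neg]
  · simp [constantPart]

/-- All equivalences and certificates for C_t are tested on these equations. They are homogeneous,
so the sign in `fourier_trace_self` does no harm. -/
theorem mem_codeOfParameter {ζ t : L} (hζ : IsPrimitiveRoot ζ 23)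
    {c : Coord → ZMod 3} :
    c ∈ codeOfParameter ζ t ↔ (∀ b, c (Sum.inr b) = -∑ i, block b c i) ∧
      fourier ζ (block 1 c) = t * fourier ζ (block 0 c) ∧
      fourier ζ⁻¹ (block 1 c) = -t⁻¹ * fourier ζ⁻¹ (block 0 c) := by
  constructor
  · intro h
    unfold codeOfParameter at h
    obtain ⟨y, hy, z, hz, rfl⟩ := Submodule.mem_sup.1 h
    obtain ⟨f, hf, e, he, rfl⟩ := Submodule.mem_sup.1 hy
    obtain ⟨a, rfl⟩ := mem_eigenCode.1 he
    obtain ⟨a', rfl⟩ := mem_eigenCode.1 hz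
    refine ⟨fun b => ?_, ?_, ?_⟩
    · have h1 := sum_block_traceWord hζ ![a, t * a] b
      have h2 := sum_block_traceWord hζ.inv ![a', -t⁻¹ * a'] b
      simp only [map_add, Pi.add_apply, Finset.sum_add_distrib, h1, h2, add_zero, traceWord_inr]
      rw [mem_standardFixedCode] at hf
      simp only [block_apply, hf, Finset.sum_const, Finset.card_univ, ZMod.card, nsmul_eq_mul]
      have : ((23 : ℕ) : ZMod 3) = -1 := by decide
      rw [this]; ring
    · simp only [map_add, fourier_block_of_mem_standardFixedCode hζ hf,
        fourier_block_traceWord hζ, fourier_block_traceWord_inv hζ]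
      simp
    · have h1 := fourier_block_traceWord hζ.inv ![a', -t⁻¹ * a']
      simp only [map_add, fourier_block_of_mem_standardFixedCode hζ.inv hf, h1,
        fourier_inv_block_traceWord hζ]
      simp
  · rintro ⟨h1, h2, h3⟩
    rw [eq_constantPart_add_traceWord hζ h1]
    refine Submodule.add_mem_sup (Submodule.add_mem_sup (constantPart_mem c) ?_) ?_
    · refine mem_eigenCode.2 ⟨-fourier ζ (block 0 c), congrArg _ ?_⟩
      ext b; fin_cases b <;> simp [h2]
    · refine mem_eigenCode.2 ⟨-fourier ζ⁻¹ (block 0 c), congrArg _ ?_⟩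
      ext b; fin_cases b <;> simp [h3]

/-- The two conjugacy classes of 23rd roots are interchangeable, so the minimal polynomial of ζ may
later be prescribed. -/
theorem codeOfParameter_inv {ζ t : L} :
    codeOfParameter ζ⁻¹ (-t⁻¹) = codeOfParameter ζ t := by
  unfold codeOfParameter
  rw [inv_inv, sup_right_comm]
  simp [inv_neg]

theorem finrank_eigenCode_le (ξ s : L) : Module.finrank (ZMod 3) (eigenCode ξ s) ≤ 11 := by
  refine (Submodule.finrank_map_le _ _).trans ?_
  have h := Module.finrank_mul_finrank (ZMod 3) L (Submodule.span L {![1, s]})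
  have h1 := finrank_span_singleton (K := L) (v := ![1, s])
    (fun h => one_ne_zero (congrFun h 0 : (1 : L) = 0))
  rw [h1, finrank_L] at h
  exact h.symm.le

theorem finrank_standardFixedCode_le : Module.finrank (ZMod 3) standardFixedCode ≤ 2 :=
  (finrank_range_le_card (R := ZMod 3) _).trans (by simp)

theorem finrank_codeOfParameter_le (ζ t : L) :
    Module.finrank (ZMod 3) (codeOfParameter ζ t) ≤ 24 := by
  have h1 := Submodule.finrank_add_le_finrank_add_finrank
    (standardFixedCode ⊔ eigenCode ζ t) (eigenCode ζ⁻¹ (-t⁻¹))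
  have h2 := Submodule.finrank_add_le_finrank_add_finrank standardFixedCode (eigenCode ζ t)
  have h3 := finrank_standardFixedCode_le
  have h4 := finrank_eigenCode_le ζ t
  have h5 := finrank_eigenCode_le ζ⁻¹ (-t⁻¹)
  unfold codeOfParameter
  omega

end Parity

/-! ### Monomial equivalence of codes. -/

section Equivalence

variable {F : Type*} [Field F] {ι κ μ : Type*}

theorem IsMonomial.trans {f : (ι → F) ≃ₗ[F] (κ → F)} {g : (κ → F) ≃ₗ[F] (μ → F)}
    (hf : IsMonomial f) (hg : IsMonomial g) : IsMonomial (f.trans g) := by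
  obtain ⟨e, u, h⟩ := hf
  obtain ⟨e', u', h'⟩ := hg
  exact ⟨e.trans e', fun k => u' k * u (e'.symm k), fun x k => by simp [h, h', mul_assoc]⟩

theorem IsMonomial.symm {f : (ι → F) ≃ₗ[F] (κ → F)} (hf : IsMonomial f) :
    IsMonomial f.symm := by
  obtain ⟨e, u, h⟩ := hf
  refine ⟨e.symm, fun k => (u (e k))⁻¹, fun x k => ?_⟩
  have h2 := h (f.symm x) (e k)
  rw [f.apply_symm_apply, e.symm_apply_apply] at h2
  simp [h2]

theorem CodeEquiv.trans {C : Submodule F (ι → F)} {D : Submodule F (κ → F)}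
    {E : Submodule F (μ → F)} (h : CodeEquiv C D) (h' : CodeEquiv D E) : CodeEquiv C E := by
  obtain ⟨f, hf, rfl⟩ := h
  obtain ⟨g, hg, rfl⟩ := h'
  exact ⟨f.trans g, hf.trans hg, by rw [← Submodule.map_comp]; rfl⟩

theorem CodeEquiv.symm {C : Submodule F (ι → F)} {D : Submodule F (κ → F)}
    (h : CodeEquiv C D) : CodeEquiv D C := by
  obtain ⟨f, hf, rfl⟩ := h
  refine ⟨f.symm, hf.symm, ?_⟩
  rw [← Submodule.map_comp]
  convert Submodule.map_id C
  ext x : 1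
  simp

/-- The monomial transformation given by a relabelling of coordinates and by scalars. -/
def monomialEquiv (e : ι ≃ κ) (u : κ → Fˣ) : (ι → F) ≃ₗ[F] (κ → F) where
  toFun x k := (u k : F) * x (e.symm k)
  map_add' x y := by ext k; simp [mul_add]
  map_smul' a x := by ext k; simp [mul_left_comm]
  invFun y i := ((u (e i))⁻¹ : Fˣ) * y (e i)
  left_inv x := by ext i; simp
  right_inv y := by ext k; simp

@[simp]
theorem monomialEquiv_apply (e : ι ≃ κ) (u : κ → Fˣ) (x : ι → F) (k : κ) :
    monomialEquiv e u x k = u k * x (e.symm k) := rfl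

theorem isMonomial_monomialEquiv (e : ι ≃ κ) (u : κ → Fˣ) : IsMonomial (monomialEquiv e u) :=
  ⟨e, u, fun _ _ => rfl⟩

theorem codeEquiv_of_mem_iff {C : Submodule F (ι → F)} {D : Submodule F (κ → F)} (e : ι ≃ κ)
    (u : κ → Fˣ) (h : ∀ c, monomialEquiv e u c ∈ D ↔ c ∈ C) : CodeEquiv C D := by
  refine ⟨monomialEquiv e u, isMonomial_monomialEquiv e u, ?_⟩
  ext y
  constructor
  · rintro ⟨c, hc, rfl⟩
    exact (h c).2 hc
  · intro hy
    refine ⟨(monomialEquiv e u).symm y, (h _).1 ?_, ?_⟩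
    · rwa [LinearEquiv.apply_symm_apply]
    · exact LinearEquiv.apply_symm_apply _ _

/-- Upper bounds for the dimensions of C and D, together with enough explicit words in W, replace an
exact description of either code. -/
theorem codeEquiv_of_le_of_finrank [Finite ι] [Finite κ] {C W : Submodule F (ι → F)}
    {D : Submodule F (κ → F)}
    (f : (ι → F) ≃ₗ[F] (κ → F)) (hf : IsMonomial f) (hC : W ≤ C)
    (hD : ∀ c ∈ W, f c ∈ D) (h1 : Module.finrank F C ≤ Module.finrank F W)
    (h2 : Module.finrank F D ≤ Module.finrank F W) : CodeEquiv C D := by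
  have hCW : W = C := Submodule.eq_of_le_of_finrank_le hC h1
  subst hCW
  refine ⟨f, hf, Submodule.eq_of_le_of_finrank_le ?_ ?_⟩
  · rintro _ ⟨c, hc, rfl⟩
    exact hD c hc
  · rwa [LinearEquiv.finrank_map_eq f W]

theorem hammingNorm_eq_of_isMonomial [Fintype ι] [Fintype κ] [DecidableEq F]
    {f : (ι → F) ≃ₗ[F] (κ → F)} (hf : IsMonomial f) (x : ι → F) :
    hammingNorm (f x) = hammingNorm x := by
  obtain ⟨e, u, h⟩ := hf
  unfold hammingNorm
  refine Finset.card_bij' (fun k _ => e.symm k) (fun i _ => e i) ?_ ?_ ?_ ?_ <;> simp [h]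

end Equivalence

/-! ### Changes of the parameter t that preserve the equivalence class. -/

section Parameter

variable {ζ : L}

/-- The relabelling of coordinates by a permutation of each of the two blocks. -/
def blockPerm (π : Fin 2 → Equiv.Perm (ZMod 23)) : Coord ≃ Coord :=
  Equiv.sumCongr (Equiv.prodShear (Equiv.refl (Fin 2)) π) (Equiv.refl (Fin 2))

@[simp]
theorem blockPerm_symm_inl (π : Fin 2 → Equiv.Perm (ZMod 23)) (b : Fin 2) (i : ZMod 23) :
    (blockPerm π).symm (Sum.inl (b, i)) = Sum.inl (b, (π b).symm i) := rfl

@[simp]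
theorem blockPerm_symm_inr (π : Fin 2 → Equiv.Perm (ZMod 23)) (b : Fin 2) :
    (blockPerm π).symm (Sum.inr b) = Sum.inr b := rfl

theorem fourier_shift {ξ : L} (hξ : ξ ^ 23 = 1) (u : ZMod 23 → ZMod 3) (k : ZMod 23) :
    fourier ξ (fun i => u (i - k)) = ξ ^ k.val * fourier ξ u := by
  rw [fourier_apply, fourier_apply, Finset.mul_sum, ← Equiv.sum_comp (Equiv.addRight k)]
  refine Finset.sum_congr rfl fun i _ => ?_
  simp only [Equiv.coe_addRight, add_sub_cancel_right]
  rw [pow_val_add hξ]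
  ring

theorem fourier_frobenius {ξ : L} (hξ : ξ ^ 23 = 1) (u : ZMod 23 → ZMod 3) (e : Equiv.Perm (ZMod 23))
    (he : ∀ i, e i = 3 * i) :
    fourier ξ (fun i => u (e.symm i)) = fourier ξ u ^ 3 := by
  rw [fourier_apply, fourier_apply, ← Equiv.sum_comp e, sum_pow_char]
  refine Finset.sum_congr rfl fun i _ => ?_
  rw [e.symm_apply_apply, mul_pow, ← map_pow, ZMod.pow_card, he]
  have : ξ ^ (3 * i).val = (ξ ^ i.val) ^ 3 := by
    rw [ZMod.val_mul, ← pow_eq_pow_mod _ hξ, ← pow_mul, mul_comm]; rfl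
  rw [this]

/-- Shifting only the second block by k steps multiplies its coefficients at ζ and ζ⁻¹ by ζ^k and
ζ^(-k), which matches the change of both t and -t⁻¹. -/
theorem codeEquiv_mul_root (hζ : IsPrimitiveRoot ζ 23) {η : L} (hη : η ^ 23 = 1) (t : L) :
    CodeEquiv (codeOfParameter ζ t) (codeOfParameter ζ (η * t)) := by
  obtain ⟨k, hk, rfl⟩ := hζ.eq_pow_of_pow_eq_one hη
  have h0 : ζ ≠ 0 := hζ.ne_zero (by norm_num)
  refine codeEquiv_of_mem_iff (blockPerm ![Equiv.refl _, Equiv.addRight (k : ZMod 23)])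
    (fun _ => 1) fun c => ?_
  rw [mem_codeOfParameter hζ, mem_codeOfParameter hζ]
  set c' := monomialEquiv (blockPerm ![Equiv.refl _, Equiv.addRight (k : ZMod 23)])
    (fun _ => (1 : (ZMod 3)ˣ)) c with hc'
  have b0 : block 0 c' = block 0 c := by ext i; simp [hc']
  have b1 : block 1 c' = fun i => block 1 c (i - k) := by ext i; simp [hc', sub_eq_add_neg]
  have f : ∀ b, c' (Sum.inr b) = c (Sum.inr b) := fun b => by simp [hc']
  have s : ∑ i, block 1 c' i = ∑ i, block 1 c i := by
    rw [b1]; exact (Equiv.subRight (k : ZMod 23)).sum_comp (fun i => block 1 c i)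
  have kv : (k : ZMod 23).val = k := ZMod.val_natCast_of_lt hk
  rw [Fin.forall_fin_two, Fin.forall_fin_two, s, b0, b1, fourier_shift hζ.pow_eq_one,
    fourier_shift hζ.inv.pow_eq_one, f, f, kv]
  refine and_congr Iff.rfl (and_congr ?_ ?_)
  · rw [mul_assoc, mul_right_inj' (pow_ne_zero _ h0)]
  · rw [mul_inv, inv_pow, neg_mul, neg_mul, mul_assoc, ← mul_neg,
      mul_right_inj' (inv_ne_zero (pow_ne_zero _ h0))]

theorem codeEquiv_neg (hζ : IsPrimitiveRoot ζ 23) (t : L) :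
    CodeEquiv (codeOfParameter ζ t) (codeOfParameter ζ (-t)) := by
  refine codeEquiv_of_mem_iff (Equiv.refl Coord)
    (Sum.elim (fun k => ![1, -1] k.1) ![1, -1]) fun c => ?_
  rw [mem_codeOfParameter hζ, mem_codeOfParameter hζ]
  set c' := monomialEquiv (Equiv.refl Coord)
    (Sum.elim (fun k => ![1, (-1 : (ZMod 3)ˣ)] k.1) ![1, -1]) c with hc'
  have b0 : block 0 c' = block 0 c := by ext i; simp [hc']
  have b1 : block 1 c' = -block 1 c := by ext i; simp [hc']
  have f0 : c' (Sum.inr 0) = c (Sum.inr 0) := by simp [hc']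
  have f1 : c' (Sum.inr 1) = -c (Sum.inr 1) := by simp [hc']
  rw [Fin.forall_fin_two, Fin.forall_fin_two, b0, b1, f0, f1, map_neg, map_neg]
  simp only [Pi.neg_apply, Finset.sum_neg_distrib, neg_inj, inv_neg, neg_mul]

/-- The two blocks, together with their check coordinates, are exchanged. -/
theorem codeEquiv_inv (hζ : IsPrimitiveRoot ζ 23) {t : L} (ht : t ≠ 0) :
    CodeEquiv (codeOfParameter ζ t) (codeOfParameter ζ t⁻¹) := by
  refine codeEquiv_of_mem_iff (Equiv.sumCongr (Equiv.prodCongr (Equiv.swap 0 1) (Equiv.refl _))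
    (Equiv.swap 0 1)) (fun _ => 1) fun c => ?_
  rw [mem_codeOfParameter hζ, mem_codeOfParameter hζ]
  set c' := monomialEquiv (Equiv.sumCongr (Equiv.prodCongr (Equiv.swap (0 : Fin 2) 1)
    (Equiv.refl (ZMod 23))) (Equiv.swap (0 : Fin 2) 1)) (fun _ => (1 : (ZMod 3)ˣ)) c with hc'
  have b0 : block 0 c' = block 1 c := by ext i; simp [hc']
  have b1 : block 1 c' = block 0 c := by ext i; simp [hc']
  have f0 : c' (Sum.inr 0) = c (Sum.inr 1) := by simp [hc']
  have f1 : c' (Sum.inr 1) = c (Sum.inr 0) := by simp [hc']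
  rw [Fin.forall_fin_two, Fin.forall_fin_two, b0, b1, f0, f1, inv_inv]
  refine and_congr and_comm (and_congr ?_ ?_)
  · rw [eq_inv_mul_iff_mul_eq₀ ht, eq_comm]
  · rw [neg_mul, neg_mul, ← neg_eq_iff_eq_neg, ← neg_eq_iff_eq_neg, eq_inv_mul_iff_mul_eq₀ ht,
      mul_neg, eq_comm, neg_eq_iff_eq_neg]

/-- Multiplying the positions of both blocks by 3 cubes every Fourier coefficient, and cubing is
injective on L. -/
theorem codeEquiv_pow_three (hζ : IsPrimitiveRoot ζ 23) (t : L) :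
    CodeEquiv (codeOfParameter ζ t) (codeOfParameter ζ (t ^ 3)) := by
  obtain ⟨e, he⟩ : ∃ e : Equiv.Perm (ZMod 23), ∀ i, e i = 3 * i :=
    ⟨Equiv.mulLeft₀ 3 (by decide), fun _ => rfl⟩
  refine codeEquiv_of_mem_iff (blockPerm fun _ => e) (fun _ => 1) fun c => ?_
  rw [mem_codeOfParameter hζ, mem_codeOfParameter hζ]
  set c' := monomialEquiv (blockPerm fun _ => e) (fun _ => (1 : (ZMod 3)ˣ)) c with hc'
  have bb : ∀ b, block b c' = fun i => block b c (e.symm i) := fun b => by ext i; simp [hc']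
  have f : ∀ b, c' (Sum.inr b) = c (Sum.inr b) := fun b => by simp [hc']
  have s : ∀ b, ∑ i, block b c' i = ∑ i, block b c i := fun b => by
    rw [bb]; exact e.symm.sum_comp (fun i => block b c i)
  have inj : Function.Injective fun x : L => x ^ 3 := frobenius_inj L 3
  have h1 : ∀ ξ : L, ξ ^ 23 = 1 → ∀ b, fourier ξ (block b c') = fourier ξ (block b c) ^ 3 :=
    fun ξ hξ b => by rw [bb, fourier_frobenius hξ _ e fun i => he i]
  simp only [f, s, h1 ζ hζ.pow_eq_one, h1 ζ⁻¹ hζ.inv.pow_eq_one]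
  rw [← mul_pow, ← inv_pow, ← Odd.neg_pow (by decide), ← mul_pow]
  exact and_congr Iff.rfl (and_congr inj.eq_iff inj.eq_iff)

end Parameter

/-! ### Certificates checked by computation with coefficient lists. -/

section ListArithmetic

/-! Polynomials over `ZMod 3` as lists of coefficients, lowest degree first. -/

/-- The value at `θ` of the polynomial with the given coefficients. -/
def listEval {R : Type*} [CommSemiring R] (θ : R) : List ℕ → R
  | [] => 0
  | a :: l => a + θ * listEval θ l

/-- The polynomial `c * l + m`, reduced modulo 3. -/
def axpyL (c : ℕ) : List ℕ → List ℕ → List ℕ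
  | [], m => m
  | a :: l, [] => Nat.mod (Nat.mul c a) 3 :: axpyL c l []
  | a :: l, b :: m => Nat.mod (Nat.add (Nat.mul c a) b) 3 :: axpyL c l m

/-- Multiplication modulo 3 of polynomials. -/
def mulL : List ℕ → List ℕ → List ℕ
  | [], _ => []
  | 0 :: l, m => 0 :: mulL l m
  | (a + 1) :: l, m => axpyL (a + 1) m (0 :: mulL l m)

/-- Multiplication by `X` modulo `X ^ n - r`. -/
def shiftL (n : ℕ) (r l : List ℕ) : List ℕ :=
  axpyL 1 (mulL (l.drop (n - 1)) r) (0 :: l.take (n - 1))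

/-- The product of two polynomials modulo `X ^ n - r`. -/
def mulModL (n : ℕ) (r : List ℕ) : List ℕ → List ℕ → List ℕ
  | [], _ => []
  | 0 :: l, s => mulModL n r l (shiftL n r s)
  | (a + 1) :: l, s => axpyL (a + 1) s (mulModL n r l (shiftL n r s))

/-- Reduction modulo `X ^ n - r`. -/
def reduceL (n : ℕ) (r l : List ℕ) : List ℕ :=
  axpyL 1 (mulModL n r (l.drop n) r) (l.take n)

/-- Whether all coefficients vanish modulo 3. -/
def isZeroL : List ℕ → Bool
  | [] => true
  | a :: l => Nat.ble (Nat.mod a 3) 0 && isZeroL l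

/-- The first `k` ternary digits of a number. -/
def digitsL : ℕ → ℕ → List ℕ
  | 0, _ => []
  | k + 1, n => Nat.mod n 3 :: digitsL k (Nat.div n 3)

/-- The number of coefficients that do not vanish modulo 3. -/
def weightL : List ℕ → ℕ
  | [] => 0
  | a :: l => Nat.add (Nat.mod (Nat.mul a a) 3) (weightL l)

theorem length_digitsL (k n : ℕ) : (digitsL k n).length = k := by
  induction k generalizing n with
  | zero => rfl
  | succ k ih => simp [digitsL, ih]

variable {R : Type*} [CommRing R]

theorem cast_mod_three (h3 : (3 : R) = 0) (a : ℕ) : ((Nat.mod a 3 : ℕ) : R) = a := by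
  change ((a % 3 : ℕ) : R) = a
  conv_rhs => rw [← Nat.mod_add_div a 3]
  simp [h3]

theorem listEval_axpyL (h3 : (3 : R) = 0) (θ : R) (c : ℕ) (l m : List ℕ) :
    listEval θ (axpyL c l m) = c * listEval θ l + listEval θ m := by
  induction l generalizing m with
  | nil => simp [axpyL, listEval]
  | cons a l ih =>
    cases m with
    | nil =>
      simp only [axpyL, listEval, ih, Nat.mul_eq, cast_mod_three h3]
      push_cast
      ring
    | cons b m =>
      simp only [axpyL, listEval, ih, Nat.add_eq, Nat.mul_eq, cast_mod_three h3]
      push_cast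
      ring

theorem listEval_mulL (h3 : (3 : R) = 0) (θ : R) (l m : List ℕ) :
    listEval θ (mulL l m) = listEval θ l * listEval θ m := by
  induction l with
  | nil => simp [mulL, listEval]
  | cons a l ih =>
    cases a with
    | zero => simp [mulL, listEval, ih, mul_assoc]
    | succ a =>
      simp only [mulL, listEval, listEval_axpyL h3, ih]
      push_cast
      ring

theorem listEval_append (θ : R) (l m : List ℕ) :
    listEval θ (l ++ m) = listEval θ l + θ ^ l.length * listEval θ m := by
  induction l with
  | nil => simp [listEval]
  | cons a l ih =>
    simp only [List.cons_append, listEval, ih, List.length_cons]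
    ring

theorem listEval_take_add_drop (θ : R) (n : ℕ) (l : List ℕ) :
    listEval θ (l.take n) + θ ^ n * listEval θ (l.drop n) = listEval θ l := by
  conv_rhs => rw [← List.take_append_drop n l, listEval_append]
  rcases le_or_gt n l.length with h | h
  · rw [List.length_take_of_le h]
  · rw [List.drop_eq_nil_of_le h.le]
    simp [listEval]

theorem listEval_shiftL (h3 : (3 : R) = 0) {θ : R} {n : ℕ} (hn : 0 < n) {r : List ℕ}
    (hr : θ ^ n = listEval θ r) (l : List ℕ) :
    listEval θ (shiftL n r l) = θ * listEval θ l := by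
  rw [shiftL, listEval_axpyL h3, listEval_mulL h3, listEval, ← hr,
    ← listEval_take_add_drop θ (n - 1) l]
  have : θ ^ n = θ * θ ^ (n - 1) := by rw [← pow_succ', Nat.sub_add_cancel hn]
  rw [this]
  push_cast
  ring

theorem listEval_mulModL (h3 : (3 : R) = 0) {θ : R} {n : ℕ} (hn : 0 < n) {r : List ℕ}
    (hr : θ ^ n = listEval θ r) (l s : List ℕ) :
    listEval θ (mulModL n r l s) = listEval θ l * listEval θ s := by
  induction l generalizing s with
  | nil => simp [mulModL, listEval]
  | cons a l ih =>
    cases a with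
    | zero =>
      simp only [mulModL, ih, listEval_shiftL h3 hn hr, listEval]
      push_cast
      ring
    | succ a =>
      simp only [mulModL, listEval_axpyL h3, ih, listEval_shiftL h3 hn hr, listEval]
      push_cast
      ring

theorem listEval_reduceL (h3 : (3 : R) = 0) {θ : R} {n : ℕ} (hn : 0 < n) {r : List ℕ}
    (hr : θ ^ n = listEval θ r) (l : List ℕ) :
    listEval θ (reduceL n r l) = listEval θ l := by
  rw [reduceL, listEval_axpyL h3, listEval_mulModL h3 hn hr, ← hr, ← listEval_take_add_drop θ n l]
  push_cast
  ring

theorem listEval_eq_zero (h3 : (3 : R) = 0) (θ : R) {l : List ℕ} (h : isZeroL l = true) :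
    listEval θ l = 0 := by
  induction l with
  | nil => rfl
  | cons a l ih =>
    simp only [isZeroL, Bool.and_eq_true, Nat.ble_eq, Nat.le_zero] at h
    rw [listEval, ih h.2, ← cast_mod_three h3, h.1]
    simp

/-- When θ raised to the length is 1, values at θ⁻¹ can be read off from the reversed list at θ, so
all computations take place modulo one polynomial. -/
theorem listEval_reverse {K : Type*} [Field K] {θ : K} (h0 : θ ≠ 0) (l : List ℕ) :
    θ * listEval θ l.reverse = θ ^ l.length * listEval θ⁻¹ l := by
  induction l with
  | nil => simp [listEval]
  | cons a l ih =>
    rw [List.reverse_cons, listEval_append, mul_add, ih]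
    simp only [List.length_reverse, listEval, List.length_cons]
    field_simp
    ring

theorem listEval_eq_sum (θ : R) (l : List ℕ) :
    listEval θ l = ∑ i ∈ Finset.range l.length, (l.getD i 0 : R) * θ ^ i := by
  induction l with
  | nil => simp [listEval]
  | cons a l ih =>
    rw [listEval, ih, List.length_cons, Finset.sum_range_succ', Finset.mul_sum, add_comm]
    simp only [List.getD_cons_succ, List.getD_cons_zero, pow_zero, mul_one, pow_succ']
    congr 1
    exact Finset.sum_congr rfl fun i _ => by ring

theorem weightL_eq_sum (l : List ℕ) :
    weightL l = ∑ i ∈ Finset.range l.length, l.getD i 0 * l.getD i 0 % 3 := by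
  induction l with
  | nil => simp [weightL]
  | cons a l ih =>
    rw [weightL, ih, List.length_cons, Finset.sum_range_succ', add_comm]
    rfl

/-- Whether the word with blocks `u` and `v` satisfies the conditions `v(ζ) = t u(ζ)` and
`t v(ζ⁻¹) = - u(ζ⁻¹)`, where `ζ ^ n` is given by `r`. -/
def isParityWordL (n : ℕ) (r t u v : List ℕ) : Bool :=
  isZeroL (reduceL n r (axpyL 2 (mulL u t) v)) &&
    isZeroL (reduceL n r (axpyL 1 (mulL v.reverse t) u.reverse))

/-- Whether each of the words `c` in the list gives a word of weight at most 12 on the two blocks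
that satisfies the parity conditions for the parameters `t`, `t ^ 2`, `t ^ 4`, and so on. -/
def areLowWeightWords (r : List ℕ) : List ℕ → List ℕ → Bool
  | _, [] => true
  | t, c :: cs =>
    (isParityWordL 11 r t ((digitsL 46 c).take 23) ((digitsL 46 c).drop 23) &&
      (weightL (digitsL 46 c)).ble 12 && Nat.ble 1 (weightL (digitsL 46 c))) &&
      areLowWeightWords r (reduceL 11 r (mulL t t)) cs

/-- The powers `X ^ 11` modulo the minimal polynomial over `ZMod 3` of a suitable primitive 23rd
root of unity. -/
def rootL : List ℕ := [1, 1, 1, 2, 2, 0, 1, 0, 1]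

/-- An element of order 3851. -/
def betaL : List ℕ := [2, 0, 0, 1, 2, 2, 0, 1, 1, 1, 1]

/-- Words of weight at most 12, as numbers in base 3. -/
def lowWeightWords : List ℕ :=
  [3100654995456145577526, 2701756815733694952, 984773282510981492001, 656515796376594323283,
   2959285740515613137100, 1643990337976505369364, 3185620903181237208208,
   6933925984639659975091, 2967854634012011197793, 102533853547659628, 24615748963821215206,
   4949521158872209245984, 5998698871653349303497, 218988692266701775743, 36489673844916524472,
   10912230070757086689, 4275749743295772801330, 36477731916346567307, 3174051275512984431486,
   36773186219723929293, 12374675622364116097, 1017925771125132216, 3002047257658561134,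
   100268983965512193, 109719308133989584323, 151478842508047932039, 12165436138156714218,
   81618338495462165460, 2854271870967389703, 3939084851776656819087, 38324987121166883805,
   1969603442074090298682, 4960937574246203, 2703836696547859380, 36479107214395393536,
   1971053946017869426821, 2954316465186257515941, 2007366895152028788003,
   3282569674228561101282, 44699796062051352534, 1368032272529364622, 8106963375063583818,
   85106090969611880472, 1653442509304237424598, 986122166687751951866, 1010458731348878289930,
   2310306802924024018530, 958012288498957124, 3282580999314004679898, 328362612423257064792,
   27618648256550986371, 2966570485090265035449, 1009087287128813031480, 25520439675998043216,
   133738895878919196885, 2957014410833492208724, 547128727117479496557, 2295618682807728,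
   2626157670769960040508, 3064198660181303405535, 660583167129862918655, 3975601283487324970056,
   462313713051181751265, 5933103832673207355429, 1646690096905407621818, 2979979506963077066289,
   427024796574686648247, 6127463406679424078715, 1677907935610836753689, 13364004667121737020,
   4057062164824845340, 146357093590806982230, 879406322644557093534, 2718586718552385360,
   182376106221254735634, 3088352798719291106496, 229996454058026502012, 9005725597477927170,
   6577297016143875402336, 2626209540679441759713, 3422157753401957325228,
   2962432778468209909344, 1977646940688933721359, 5945248641375230034960,
   1033435343439700251364, 137786946438253159824, 4944117288660181769170, 3112545811601135757276,
   23066628751240, 255376243848092521365, 1245501971043662256813, 1030250331613939512321,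
   2958582067640413409115, 986136992395078425408, 2702665766924264350, 8105120669538694954,
   838879328740799486359, 87955456286409711148, 2713554463469931516, 5937076894141922473062,
   255615007218948240450, 24322126174704578182, 28368320734840295520, 984800687963824483958,
   1322489459512484941790, 36473316935086408826, 328357251627588935289, 328457147174686869798,
   1357607262472198199847, 8267586373271589390, 44594785629267731488, 79750351964520059490,
   77148644339561645394, 336452875994212135296, 659216736655665045055, 428038429994382,
   332426263671048123387, 4054549105806466635, 31273628467997760759, 16239892378169959182,
   1057717519674154103664, 2955998475074908050562, 985523236194385753812, 329618937808791924402,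
   2042649627834216962214, 2990786322954985142949, 2994845705751387663033, 74597077337874106050,
   997729692642281171538, 3611427043887636747804, 3294744748646972892108, 328261101880909063284,
   2297806190621600793688, 660722146744682300422, 3064185708505880850266, 112571046015503059666,
   328707264103902389360, 5923056803032605177558, 2736931230116859940722, 16216016104820450675,
   8672180427635163051, 996928567990184485386, 1969698076615282004001, 5912679958560053743788,
   222890876767839850103, 5908664328471351040581, 2626055739751771636095, 6139621103707162148007,
   5912828703474293989819, 1009102934010046063512, 2078962234736917789714,
   1970175537362854148358, 1982700220199440640383, 4924308500874915819822, 14071835408427548856,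
   774044860841501978916, 36478556292399463422, 1969551208904728071618, 1641319014904495276434,
   36979076905469798337, 332309545584884178789, 670072552207537324743, 331015520436686916336,
   2966937342156153017586, 39193291026933604917, 13510995496180387929, 4404651865761664136,
   3949890468513015203064, 7890625146479187708172, 8111243839947372055, 40753622548498,
   3367924526969010613377, 100480521313075105, 6908257692255623025762]

theorem areLowWeightWords_lowWeightWords :
    areLowWeightWords rootL (reduceL 11 rootL (mulL betaL betaL)) lowWeightWords = true := by
  decide +kernel

end ListArithmetic

/-! ### Prescribing the minimal polynomial of a root of unity, and the element β. -/

section Roots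

variable {R : Type*} [CommRing R]

/-- The polynomial `X ^ n - r`. -/
def polyL (n : ℕ) (r : List ℕ) : List ℕ := axpyL 2 r (List.replicate n 0 ++ [1])

theorem listEval_replicate_append (θ : R) (n : ℕ) :
    listEval θ (List.replicate n 0 ++ [1]) = θ ^ n := by
  induction n with
  | zero => simp [listEval]
  | succ n ih => simp [List.replicate_succ, listEval, ih, pow_succ']

theorem listEval_polyL (h3 : (3 : R) = 0) (θ : R) (n : ℕ) (r : List ℕ) :
    listEval θ (polyL n r) = θ ^ n - listEval θ r := by
  rw [polyL, listEval_axpyL h3, listEval_replicate_append]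
  push_cast
  linear_combination listEval θ r * h3

/-- With g = X^n - r and g* its reversal, the hypothesis is the factorisation X^p - 1 = -(X - 1) g
g* over 𝔽₃. A root θ ≠ 1 is a root of g or of g*, and in the latter case θ⁻¹ is a root of g. -/
theorem pow_eq_listEval_or {K : Type*} [Field K] (h3 : (3 : K) = 0) {θ : K} {p n : ℕ}
    (hθ : θ ^ p = 1) (h1 : θ ≠ 1) (h0 : θ ≠ 0) {r : List ℕ}
    (h : isZeroL (axpyL 1 (polyL p [1]) (mulL (polyL 1 [1])
      (mulL (polyL n r) (polyL n r).reverse))) = true) :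
    θ ^ n = listEval θ r ∨ θ⁻¹ ^ n = listEval θ⁻¹ r := by
  have h2 := listEval_eq_zero h3 θ h
  have h4 := listEval_reverse h0 (polyL n r)
  simp only [listEval_axpyL h3, listEval_mulL h3, listEval_polyL h3, listEval, hθ] at h2 h4
  simp only [Nat.cast_one, mul_zero, add_zero, sub_self, pow_one, zero_add] at h2
  rw [← sub_eq_zero, ← sub_eq_zero (a := θ⁻¹ ^ n)]
  rcases mul_eq_zero.1 h2 with h5 | h5
  · exact absurd (sub_eq_zero.1 h5) h1
  · rcases mul_eq_zero.1 h5 with h6 | h6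
    · exact Or.inl h6
    · rw [h6, mul_zero] at h4
      exact Or.inr ((mul_eq_zero.1 h4.symm).resolve_left (pow_ne_zero _ h0))

theorem pow_eleven_eq_or {ζ : L} (hζ : IsPrimitiveRoot ζ 23) :
    ζ ^ 11 = listEval ζ rootL ∨ ζ⁻¹ ^ 11 = listEval ζ⁻¹ rootL :=
  pow_eq_listEval_or three_eq_zero hζ.pow_eq_one (hζ.ne_one (by norm_num))
    (hζ.ne_zero (by norm_num)) (p := 23) (by decide +kernel)

theorem isPrimitiveRoot_beta {ζ : L} (hr : ζ ^ 11 = listEval ζ rootL) :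
    IsPrimitiveRoot (listEval ζ betaL) 3851 := by
  have h3 := three_eq_zero
  have hm : ∀ l m, listEval ζ (reduceL 11 rootL (mulL l m)) = listEval ζ l * listEval ζ m :=
    fun l m => by rw [listEval_reduceL h3 (by norm_num) hr, listEval_mulL h3]
  have hf : ∀ (bs : List Bool) (l : List ℕ),
      listEval ζ (bs.foldl (fun a b => if b = true then
        reduceL 11 rootL (mulL (reduceL 11 rootL (mulL a a)) betaL)
        else reduceL 11 rootL (mulL a a)) l) =
      bs.foldl (fun a b => if b = true then a * a * listEval ζ betaL else a * a) (listEval ζ l) := by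
    intro bs
    induction bs with
    | nil => intro l; rfl
    | cons b bs ih =>
      intro l
      rw [List.foldl_cons, List.foldl_cons, ih]
      cases b <;> simp [hm]
  rw [IsPrimitiveRoot.iff_orderOf]
  have : Fact (Nat.Prime 3851) := ⟨by norm_num⟩
  refine orderOf_eq_prime ?_ ?_
  -- Square-and-multiply: these are the binary digits of 3851 = 111100001011₂ after the leading one.
  · have h := hf [true, true, true, false, false, false, false, true, false, true, true] betaL
    have h' : isZeroL (axpyL 2 [1] ([true, true, true, false, false, false, false, true, false,
        true, true].foldl (fun a b => if b = true then
        reduceL 11 rootL (mulL (reduceL 11 rootL (mulL a a)) betaL)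
        else reduceL 11 rootL (mulL a a)) betaL)) = true := by decide +kernel
    have h4 := listEval_eq_zero h3 ζ h'
    rw [listEval_axpyL h3, h] at h4
    simp only [List.foldl_cons, List.foldl_nil, if_true, Bool.false_eq_true, if_false,
      listEval] at h4
    push_cast at h4
    linear_combination h4 - h3
  -- The explicit list is the inverse of β - 1, which shows β ≠ 1.
  · have h' : isZeroL (axpyL 2 [1] (reduceL 11 rootL (mulL (axpyL 2 [1] betaL)
        [2, 2, 0, 2, 1, 1, 2, 2, 0, 0, 2]))) = true := by decide +kernel
    have h4 := listEval_eq_zero h3 ζ h'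
    rw [listEval_axpyL h3, hm, listEval_axpyL h3] at h4
    intro h5
    have h6 : listEval ζ [1] = 1 := by simp [listEval]
    rw [h5, h6] at h4
    push_cast at h4
    refine one_ne_zero (α := L) ?_
    linear_combination h4 * 2 -
      (1 + 2 * (listEval ζ [2, 2, 0, 2, 1, 1, 2, 2, 0, 0, 2])) * h3

end Roots

/-! ### Low-weight words from the certificates. -/

section Words

/-- The word with the given blocks and parity checks. -/
def listWord (u v : List ℕ) : Coord → ZMod 3 :=
  Sum.elim (fun k => ((![u, v] k.1).getD k.2.val 0 : ℕ))
    fun b => -∑ i : ZMod 23, (((![u, v] b).getD i.val 0 : ℕ) : ZMod 3)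

theorem fourier_list {l : List ℕ} (hl : l.length = 23) (ξ : L) :
    fourier ξ (fun i => (l.getD i.val 0 : ℕ)) = listEval ξ l := by
  rw [listEval_eq_sum, hl, fourier_apply]
  simp only [map_natCast]
  exact Fin.sum_univ_eq_sum_range (fun i => (l.getD i 0 : L) * ξ ^ i) 23

theorem listWord_mem {ζ : L} (hζ : IsPrimitiveRoot ζ 23) (hr : ζ ^ 11 = listEval ζ rootL)
    {t u v : List ℕ} (hu : u.length = 23) (hv : v.length = 23)
    (ht : listEval ζ t ≠ 0) (h : isParityWordL 11 rootL t u v = true) :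
    listWord u v ∈ codeOfParameter ζ (listEval ζ t) := by
  have h3 := three_eq_zero
  have h0 : ζ ≠ 0 := hζ.ne_zero (by norm_num)
  simp only [isParityWordL, Bool.and_eq_true] at h
  have h1 := listEval_eq_zero h3 ζ h.1
  have h2 := listEval_eq_zero h3 ζ h.2
  rw [listEval_reduceL h3 (by norm_num) hr, listEval_axpyL h3, listEval_mulL h3] at h1 h2
  have r1 := listEval_reverse h0 u
  have r2 := listEval_reverse h0 v
  rw [hu, hζ.pow_eq_one, one_mul] at r1
  rw [hv, hζ.pow_eq_one, one_mul] at r2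
  push_cast at h1 h2
  rw [mem_codeOfParameter hζ]
  have b0 : block 0 (listWord u v) = fun i => ((u.getD i.val 0 : ℕ) : ZMod 3) := rfl
  have b1 : block 1 (listWord u v) = fun i => ((v.getD i.val 0 : ℕ) : ZMod 3) := rfl
  refine ⟨fun b => rfl, ?_, ?_⟩
  · rw [b0, b1, fourier_list hu, fourier_list hv]
    linear_combination h1 - listEval ζ u * listEval ζ t * h3
  · rw [b0, b1, fourier_list hu, fourier_list hv, ← r1, ← r2]
    field_simp
    linear_combination h2

theorem weightL_append (l m : List ℕ) : weightL (l ++ m) = weightL l + weightL m := by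
  induction l with
  | nil => simp [weightL]
  | cons a l ih => simp only [List.cons_append, weightL, ih, Nat.add_eq, add_assoc]

theorem sum_ite_list {l : List ℕ} (hl : l.length = 23) :
    (∑ i : ZMod 23, if ((l.getD i.val 0 : ℕ) : ZMod 3) ≠ 0 then 1 else 0) = weightL l := by
  rw [weightL_eq_sum, hl]
  have h : ∀ n : ℕ, (if (n : ZMod 3) ≠ 0 then 1 else 0) = n * n % 3 := by
    intro n
    rw [Nat.mul_mod]
    simp only [ne_eq, ZMod.natCast_eq_zero_iff, Nat.dvd_iff_mod_eq_zero]
    have := Nat.mod_lt n (show 0 < 3 by norm_num)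
    interval_cases n % 3 <;> rfl
  simp only [h]
  exact Fin.sum_univ_eq_sum_range (fun i => l.getD i 0 * l.getD i 0 % 3) 23

theorem hammingNorm_listWord {u v : List ℕ} (hu : u.length = 23) (hv : v.length = 23) :
    weightL u + weightL v ≤ hammingNorm (listWord u v) ∧
      hammingNorm (listWord u v) ≤ weightL u + weightL v + 2 := by
  have h : hammingNorm (listWord u v) = weightL u + weightL v +
      ∑ b : Fin 2, if listWord u v (Sum.inr b) ≠ 0 then 1 else 0 := by
    rw [hammingNorm, Finset.card_filter, Fintype.sum_sum_type, Fintype.sum_prod_type,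
      Fin.sum_univ_two, ← sum_ite_list hu, ← sum_ite_list hv]
    rfl
  have h1 : (∑ b : Fin 2, if listWord u v (Sum.inr b) ≠ 0 then 1 else 0) ≤ 2 := by
    rw [Fin.sum_univ_two]
    split_ifs <;> simp
  omega

theorem exists_low_weight_of_areLowWeightWords {ζ : L} (hζ : IsPrimitiveRoot ζ 23)
    (hr : ζ ^ 11 = listEval ζ rootL) {cs : List ℕ} : ∀ {t : List ℕ}, listEval ζ t ≠ 0 →
    areLowWeightWords rootL t cs = true → ∀ n < cs.length,
    ∃ c ∈ codeOfParameter ζ (listEval ζ t ^ 2 ^ n), c ≠ 0 ∧ hammingNorm c < 15 := by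
  induction cs with
  | nil => intro t _ _ n hn; simp at hn
  | cons c cs ih =>
    intro t ht h n hn
    simp only [areLowWeightWords, Bool.and_eq_true, Nat.ble_eq] at h
    obtain ⟨⟨⟨h1, h2⟩, h3⟩, h4⟩ := h
    cases n with
    | zero =>
      set l := digitsL 46 c with hl
      have hll : l.length = 46 := length_digitsL 46 c
      have hu : (l.take 23).length = 23 := by simp [hll]
      have hv : (l.drop 23).length = 23 := by simp [hll]
      have hw : weightL (l.take 23) + weightL (l.drop 23) = weightL l := by
        rw [← weightL_append, List.take_append_drop]
      have hh := hammingNorm_listWord hu hv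
      -- Weight at most 12 on the blocks plus two check coordinates gives at most 14.
      refine ⟨_, by simpa using listWord_mem hζ hr hu hv ht h1, ?_, by omega⟩
      rw [← hammingNorm_ne_zero_iff]
      omega
    | succ n =>
      have h5 : listEval ζ (reduceL 11 rootL (mulL t t)) = listEval ζ t ^ 2 := by
        rw [listEval_reduceL three_eq_zero (by norm_num) hr, listEval_mulL three_eq_zero, sq]
      have := ih (by rw [h5]; exact pow_ne_zero _ ht) h4 n (by simpa using hn)
      rwa [h5, ← pow_mul, ← pow_succ'] at this

/-- The list starts at the parameter β², so its entry in position n, counted from 0, belongs to the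
exponent 2^(n+1); the 174 entries cover 1 ≤ n < 175. -/
theorem exists_low_weight {ζ : L} (hζ : IsPrimitiveRoot ζ 23)
    (hr : ζ ^ 11 = listEval ζ rootL) {n : ℕ} (h1 : 1 ≤ n) (h2 : n < 175) :
    ∃ c ∈ codeOfParameter ζ (listEval ζ betaL ^ 2 ^ n), c ≠ 0 ∧ hammingNorm c < 15 := by
  obtain ⟨n, rfl⟩ := Nat.exists_eq_add_of_le' h1
  have h5 : listEval ζ (reduceL 11 rootL (mulL betaL betaL)) = listEval ζ betaL ^ 2 := by
    rw [listEval_reduceL three_eq_zero (by norm_num) hr, listEval_mulL three_eq_zero, sq]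
  have h0 := (isPrimitiveRoot_beta hr).ne_zero (by norm_num)
  have := exists_low_weight_of_areLowWeightWords hζ hr
    (by rw [h5]; exact pow_ne_zero _ h0) areLowWeightWords_lowWeightWords n
    (by rw [show lowWeightWords.length = 174 from rfl]; omega)
  rwa [h5, ← pow_mul, ← pow_succ'] at this

end Words

/-! ### Dimension from an information set. -/

section Independence

theorem le_finrank_span_of_systematic {F : Type*} [Field F] {ι κ : Type*} [Fintype κ]
    [DecidableEq κ] (w : κ → ι → F) (p : κ → ι)
    (h : ∀ k j, w k (p j) = (Pi.single k 1 : κ → F) j) :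
    Fintype.card κ = Module.finrank F (Submodule.span F (Set.range w)) := by
  refine (finrank_span_eq_card (LinearIndependent.of_comp (LinearMap.funLeft F F p) ?_)).symm
  convert Pi.linearIndependent_single_one κ F with k
  ext j
  exact h k j

end Independence

/-! ### The Pless code is C₁. -/

section Pless

/-- The values of the quadratic character modulo 23. -/
def chiL : List ℕ :=
  [0, 1, 1, 1, 1, 2, 1, 2, 1, 1, 2, 2, 1, 1, 2, 2, 1, 2, 1, 2, 2, 2, 2]

/-- The quadratic character modulo 23 as a ternary word. -/
def chi (j : ZMod 23) : ZMod 3 := ((quadraticChar (ZMod 23) j : ℤ) : ZMod 3)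

theorem chi_eq : chi = fun j => ((chiL.getD j.val 0 : ℕ) : ZMod 3) :=
  funext (by decide +kernel)

/-- This is a quadratic Gauss sum. Its square is χ(-1) · 23 = 1 in L, so it is ±1, and the choice of
`rootL` selects the sign. -/
theorem fourier_chi {ζ : L} (hr : ζ ^ 11 = listEval ζ rootL) : fourier ζ chi = 1 := by
  have h3 := three_eq_zero
  rw [chi_eq, fourier_list rfl]
  have h := listEval_eq_zero h3 ζ
    (l := axpyL 2 [1] (reduceL 11 rootL chiL)) (by decide +kernel)
  rw [listEval_axpyL h3, listEval_reduceL h3 (by norm_num) hr] at h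
  simp only [listEval] at h ⊢
  push_cast at h ⊢
  linear_combination h - h3

theorem chi_neg (j : ZMod 23) : chi (-j) = -chi j := by
  revert j
  decide +kernel

theorem fourier_inv_chi {ζ : L} (hζ : IsPrimitiveRoot ζ 23) (hr : ζ ^ 11 = listEval ζ rootL) :
    fourier ζ⁻¹ chi = -1 := by
  rw [← fourier_chi hr, fourier_apply, fourier_apply, ← Finset.sum_neg_distrib,
    ← Equiv.sum_comp (Equiv.neg (ZMod 23))]
  refine Finset.sum_congr rfl fun j _ => ?_
  rw [Equiv.neg_apply, chi_neg, inv_pow_val hζ.pow_eq_one, neg_neg, map_neg, neg_mul]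

/-- The labelling of the coordinates of the Pless code by blocks. -/
def plessCoord : Coord → Option (ZMod 23) ⊕ Option (ZMod 23) :=
  -- The infinite coordinates are crossed: the check of the identity block is the entry S(i, ∞) in
  -- the other half.
  Sum.elim (fun k => ![Sum.inl (some k.2), Sum.inr (some k.2)] k.1) ![Sum.inr none, Sum.inl none]

theorem plessCoord_bijective : Function.Bijective plessCoord := by
  rw [Fintype.bijective_iff_injective_and_card]
  exact ⟨by decide +kernel, rfl⟩

theorem fourier_single (ξ : L) (i : ZMod 23) : fourier ξ (Pi.single i 1) = ξ ^ i.val := by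
  rw [fourier_apply, Finset.sum_eq_single i]
  · simp
  · intro j _ hj; simp [hj]
  · simp

/-- The row of ∞ lies in F. In the row of i the blocks are a unit vector and χ shifted by i, so
their Fourier coefficients have ratio 1 at ζ and -1 at ζ⁻¹, by the Gauss sums. Thus t = 1. -/
theorem codeEquiv_P48 {ζ : L} (hζ : IsPrimitiveRoot ζ 23) (hr : ζ ^ 11 = listEval ζ rootL) :
    CodeEquiv (codeOfParameter ζ 1) P48 := by
  set e := (Equiv.ofBijective plessCoord plessCoord_bijective).symm with he
  have hcard : 24 = Module.finrank (ZMod 3) P48 :=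
    le_finrank_span_of_systematic (κ := Option (ZMod 23)) _ Sum.inl fun k j => rfl
  refine (codeEquiv_of_le_of_finrank (monomialEquiv e fun _ => 1) (isMonomial_monomialEquiv _ _)
    (le_refl P48) (fun c hc => ?_) le_rfl ?_).symm
  · suffices h : P48 ≤ (codeOfParameter ζ 1).comap (monomialEquiv e fun _ => 1).toLinearMap from h hc
    refine Submodule.span_le.2 ?_
    rintro _ ⟨i, rfl⟩
    change monomialEquiv e (fun _ => 1) (Sum.elim (Pi.single i 1) (plessMatrix 23 i)) ∈
      codeOfParameter ζ 1
    set c := monomialEquiv e (fun _ => 1) (Sum.elim (Pi.single i 1) (plessMatrix 23 i)) with hc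
    have hcc : ∀ k, c k = (Sum.elim (Pi.single i 1) (plessMatrix 23 i) :
        Option (ZMod 23) ⊕ Option (ZMod 23) → ZMod 3) (plessCoord k) := by
      intro k
      simp [hc, he]
    rcases i with _ | i
    · have hF : c ∈ standardFixedCode := by
        rw [mem_standardFixedCode]
        intro b j
        rw [hcc, hcc]
        fin_cases b <;> simp [plessCoord, plessMatrix]
      exact Submodule.mem_sup_left (Submodule.mem_sup_left hF)
    · have b0 : block 0 c = Pi.single i 1 := by
        ext j
        rw [block_apply, hcc]
        simp [plessCoord, Pi.single_apply]
      have b1 : block 1 c = fun j => chi (j - i) := by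
        ext j
        rw [block_apply, hcc]
        rfl
      rw [mem_codeOfParameter hζ, Fin.forall_fin_two, b0, b1, fourier_single, fourier_single,
        fourier_shift hζ.pow_eq_one, fourier_shift hζ.inv.pow_eq_one, fourier_chi hr,
        fourier_inv_chi hζ hr, hcc, hcc]
      refine ⟨⟨?_, ?_⟩, by ring, by simp⟩
      · have : plessMatrix 23 (some i) none = -1 := by
          change chi (-1) = -1
          decide +kernel
        simp [plessCoord, this]
      · have : ∑ j, chi (j - i) = 0 :=
          (Equiv.sum_comp (Equiv.subRight i) chi).trans (by decide +kernel)
        simp [plessCoord, this]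
  · rw [← hcard]
    exact finrank_codeOfParameter_le ζ 1

end Pless

/-! ### The extended quadratic residue code is C_β. -/

section QuadraticResidue

/-- The power `X ^ 23` modulo the minimal polynomial over `ZMod 3` of a suitable primitive 47th
root of unity. -/
def rootL' : List ℕ :=
  [1, 0, 0, 1, 0, 2, 1, 0, 2, 0, 0, 1, 0, 1, 2, 0, 2, 2, 2, 0, 0, 2, 2]

variable {α : AlgebraicClosure (ZMod 3)}

theorem three_eq_zero' : (3 : AlgebraicClosure (ZMod 3)) = 0 := by
  have := CharP.cast_eq_zero (AlgebraicClosure (ZMod 3)) 3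
  exact_mod_cast this

theorem pow_twentythree_eq_or (hα : IsPrimitiveRoot α 47) :
    α ^ 23 = listEval α rootL' ∨ α⁻¹ ^ 23 = listEval α⁻¹ rootL' :=
  pow_eq_listEval_or three_eq_zero' hα.pow_eq_one (hα.ne_one (by norm_num))
    (hα.ne_zero (by norm_num)) (p := 47) (by decide +kernel)

theorem listEval_pow_three {R : Type*} [CommRing R] [CharP R 3] (θ : R) (l : List ℕ) :
    listEval (θ ^ 3) l = listEval θ l ^ 3 := by
  induction l with
  | nil => simp [listEval]
  | cons a l ih =>
    have h := add_pow_char (a : R) (θ * listEval θ l) 3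
    have h' : (a : R) ^ 3 = a := map_natCast (frobenius R 3) a
    rw [listEval, listEval, h, mul_pow, ih, h']

theorem exists_eq_three_pow {r : ZMod 47} (h0 : r ≠ 0) (h : IsSquare r) :
    ∃ k : ℕ, r = 3 ^ k := by
  obtain ⟨s, rfl⟩ := h
  have key : ∀ s : ZMod 47, s ≠ 0 → ∃ k : Fin 23, s * s = 3 ^ k.val := by decide +kernel
  obtain ⟨k, hk⟩ := key s (by rintro rfl; simp at h0)
  exact ⟨k, hk⟩

theorem pow_val_three_pow (hα : α ^ 47 = 1) (k : ℕ) :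
    α ^ (3 ^ k : ZMod 47).val = α ^ 3 ^ k := by
  have : (3 ^ k : ZMod 47) = ((3 ^ k : ℕ) : ZMod 47) := by push_cast; rfl
  rw [this, ZMod.val_natCast, ← pow_eq_pow_mod _ hα]

/-- The nonzero squares modulo 47 are the powers of 3, so α^r is a Frobenius conjugate of α. Hence
one polynomial over 𝔽₃ controls all the defining zeros. -/
theorem pow_twentythree_of_isSquare (hα : α ^ 47 = 1) (hr : α ^ 23 = listEval α rootL')
    {r : ZMod 47} (h0 : r ≠ 0) (h : IsSquare r) :
    (α ^ r.val) ^ 23 = listEval (α ^ r.val) rootL' := by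
  obtain ⟨k, rfl⟩ := exists_eq_three_pow h0 h
  rw [pow_val_three_pow hα]
  clear h0 h
  induction k with
  | zero => simpa using hr
  | succ k ih =>
    rw [pow_succ 3 k, pow_mul, listEval_pow_three, ← ih]
    ring

/-- The labelling of the coordinates of the quadratic residue code by blocks. -/
def qrCoord : Coord → Option (ZMod 47) :=
  -- Multiplication by 2 modulo 47 has as cycles the nonzero squares (powers of 2) and the
  -- nonsquares (their negatives); it fixes 0 and ∞. This supplies the automorphism of order 23.
  Sum.elim (fun k => some (![1, -1] k.1 * 2 ^ k.2.val)) ![some 0, none]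

theorem qrCoord_bijective : Function.Bijective qrCoord := by
  rw [Fintype.bijective_iff_injective_and_card]
  exact ⟨by decide +kernel, rfl⟩

/-- The multiple `X ^ n - (X ^ n mod g)` of the generator polynomial `g`. -/
def qrL (n : ℕ) : List ℕ :=
  axpyL 2 (reduceL 23 rootL' (List.replicate n 0 ++ [1])) (List.replicate n 0 ++ [1])

/-- The two blocks of the word given by `qrL`. -/
def qrBlockL (a n : ℕ) : List ℕ :=
  (List.range 23).map fun i => (qrL n).getD (a * 2 ^ i % 47) 0

/-- The words of the extended quadratic residue code given by `qrL`. -/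
def qrWord (n : ℕ) : Option (ZMod 47) → ZMod 3
  | some i => (((qrL n).getD i.val 0 : ℕ) : ZMod 3)
  | none => -∑ i : ZMod 47, (((qrL n).getD i.val 0 : ℕ) : ZMod 3)

/-- The mechanical verifications about `qrL`. -/
def checkQR (n : ℕ) : Bool :=
  (qrL n).length == n + 1 &&
    isParityWordL 11 rootL betaL (qrBlockL 1 n) (qrBlockL 46 n) &&
    -- Reducing modulo X - 1 sums the coefficients. The last two tests are the parity checks at the
    -- coordinates 0 and ∞.
    isZeroL (reduceL 1 [1] (axpyL 1 [(qrL n).getD 0 0] (qrBlockL 1 n))) &&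
    isZeroL (reduceL 1 [1] (axpyL 2 (qrL n) (qrBlockL 46 n)))

theorem checkQR_eq_true (k : Fin 24) : checkQR (23 + k.val) = true := by
  revert k
  decide +kernel

theorem sum_getD {R : Type*} [CommRing R] (θ : R) {l : List ℕ} {n : ℕ} [NeZero n] (h : l.length ≤ n) :
    ∑ i : ZMod n, ((l.getD i.val 0 : ℕ) : R) * θ ^ i.val = listEval θ l := by
  obtain _ | n := n
  · exact absurd rfl (NeZero.ne 0)
  rw [listEval_eq_sum]
  refine (Fin.sum_univ_eq_sum_range (fun i => (l.getD i 0 : R) * θ ^ i) (n + 1)).trans ?_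
  refine (Finset.sum_subset (Finset.range_subset_range.2 h) fun i _ hi => ?_).symm
  rw [List.getD_eq_default _ _ (by simpa using hi)]
  simp

theorem sum_getD_one {l : List ℕ} {n : ℕ} [NeZero n] (h : l.length ≤ n) :
    ∑ i : ZMod n, ((l.getD i.val 0 : ℕ) : ZMod 3) = listEval 1 l := by
  simpa using sum_getD (1 : ZMod 3) h

theorem qrWord_mem (hα : α ^ 47 = 1) (hr : α ^ 23 = listEval α rootL') (k : Fin 24) :
    qrWord (23 + k.val) ∈ Q48 α := by
  have h := checkQR_eq_true k
  simp only [checkQR, Bool.and_eq_true, beq_iff_eq] at h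
  refine ⟨fun r h0 hs => ?_, rfl⟩
  have h1 := pow_twentythree_of_isSquare hα hr h0 hs
  simp only [qrWord, map_natCast]
  rw [sum_getD _ (by omega), qrL, listEval_axpyL three_eq_zero', listEval_reduceL three_eq_zero'
    (by norm_num) h1]
  push_cast
  linear_combination
    listEval (α ^ r.val) (List.replicate (23 + k.val) 0 ++ [1]) * three_eq_zero'

theorem getD_qrBlockL (a n : ℕ) (i : ZMod 23) :
    (qrBlockL a n).getD i.val 0 = (qrL n).getD (a * 2 ^ i.val % 47) 0 := by
  have hi : i.val < 23 := i.val_lt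
  simp [qrBlockL, List.getD_eq_getElem?_getD, hi]

theorem qrWord_qrCoord (k : Fin 24) (x : Coord) :
    qrWord (23 + k.val) (qrCoord x) =
      listWord (qrBlockL 1 (23 + k.val)) (qrBlockL 46 (23 + k.val)) x := by
  have h := checkQR_eq_true k
  have hn : 23 + k.val + 1 ≤ 47 := by omega
  generalize 23 + k.val = n at h hn ⊢
  simp only [checkQR, Bool.and_eq_true, beq_iff_eq] at h
  have h3 : (3 : ZMod 3) = 0 := by decide
  have h1 := listEval_eq_zero h3 1 h.1.2
  have h2 := listEval_eq_zero h3 1 h.2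
  rw [listEval_reduceL h3 (by norm_num) (by simp [listEval]), listEval_axpyL h3] at h1 h2
  have hs : ∀ a, ∑ i : ZMod 23, (((qrBlockL a n).getD i.val 0 : ℕ) : ZMod 3) =
      listEval 1 (qrBlockL a n) := fun a => sum_getD_one (by simp [qrBlockL])
  push_cast at h1 h2
  obtain ⟨b, i⟩ | b := x
  · have hc : (![1, -1] b * 2 ^ i.val : ZMod 47) = ((![1, 46] b * 2 ^ i.val : ℕ) : ZMod 47) := by
      fin_cases b
      · simp
      · have : (-1 : ZMod 47) = (46 : ℕ) := by decide
        simp [this]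
    have hq : qrCoord (Sum.inl (b, i)) = some ((![1, 46] b * 2 ^ i.val : ℕ) : ZMod 47) :=
      congrArg some hc
    rw [hq]
    change (((qrL n).getD _ 0 : ℕ) : ZMod 3) = ((![qrBlockL 1 n, qrBlockL 46 n] b).getD i.val 0 : ℕ)
    rw [ZMod.val_natCast]
    fin_cases b
    · exact congrArg _ (getD_qrBlockL 1 n i).symm
    · exact congrArg _ (getD_qrBlockL 46 n i).symm
  · fin_cases b
    · change (((qrL n).getD 0 0 : ℕ) : ZMod 3) = -∑ i : ZMod 23, (((qrBlockL 1 n).getD i.val 0 : ℕ) : ZMod 3)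
      rw [hs]
      simp only [listEval] at h1
      linear_combination h1
    · change -∑ i : ZMod 47, (((qrL n).getD i.val 0 : ℕ) : ZMod 3) =
        -∑ i : ZMod 23, (((qrBlockL 46 n).getD i.val 0 : ℕ) : ZMod 3)
      rw [hs, sum_getD_one (by omega)]
      linear_combination h2 - listEval 1 (qrL n) * h3

/-- Positions are negated. With `pow_twentythree_eq_or` this makes the choice of α immaterial. -/
theorem codeEquiv_Q48_inv (hα : α ^ 47 = 1) : CodeEquiv (Q48 α) (Q48 α⁻¹) := by
  have n1 : ∀ i, (Equiv.optionCongr (Equiv.neg (ZMod 47))).symm (some i) = some (-i) :=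
    fun _ => rfl
  have n2 : (Equiv.optionCongr (Equiv.neg (ZMod 47))).symm none = none := rfl
  have key : ∀ α : AlgebraicClosure (ZMod 3), α ^ 47 = 1 → ∀ c ∈ Q48 α,
      monomialEquiv (Equiv.optionCongr (Equiv.neg (ZMod 47))) (fun _ => 1) c ∈ Q48 α⁻¹ := by
    intro α hα c hc
    refine ⟨fun r h0 hs => ?_, ?_⟩
    · rw [← hc.1 r h0 hs, ← Equiv.sum_comp (Equiv.neg (ZMod 47))]
      refine Finset.sum_congr rfl fun i _ => ?_
      have hr : (α ^ r.val) ^ 47 = 1 := by rw [← pow_mul, mul_comm, pow_mul, hα, one_pow]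
      rw [inv_pow, Equiv.neg_apply, inv_pow_val hr, neg_neg]
      simp [n1]
    · have := hc.2
      rw [← Equiv.sum_comp (Equiv.neg (ZMod 47))] at this
      simpa [n1, n2] using this
  refine codeEquiv_of_mem_iff (Equiv.optionCongr (Equiv.neg (ZMod 47))) (fun _ => 1)
    fun c => ⟨fun h => ?_, key α hα c⟩
  have h2 := key α⁻¹ (by rw [inv_pow, hα, inv_one]) _ h
  rw [inv_inv] at h2
  convert h2
  ext k
  cases k <;> simp [n1, n2]

/-- The 24 positions 23, …, 46 determine a word: if they vanish, a polynomial of degree below 23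
remains, with the 23 distinct zeros α^(3^j), and Vandermonde applies. -/
theorem finrank_Q48_le (hα : IsPrimitiveRoot α 47) : Module.finrank (ZMod 3) (Q48 α) ≤ 24 := by
  let f : Q48 α →ₗ[ZMod 3] (Fin 24 → ZMod 3) :=
    LinearMap.funLeft (ZMod 3) (ZMod 3) (fun k => some ((23 + k.val : ℕ) : ZMod 47)) ∘ₗ
      (Q48 α).subtype
  have hf : Function.Injective f := by
    rw [injective_iff_map_eq_zero]
    rintro ⟨c, hc⟩ h
    have h1 : ∀ i : ℕ, 23 ≤ i → i < 47 → c (some (i : ZMod 47)) = 0 := by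
      intro i hi hi'
      have := congrFun h ⟨i - 23, by omega⟩
      simp only [f, LinearMap.comp_apply, LinearMap.funLeft_apply, Submodule.subtype_apply,
        Pi.zero_apply, Nat.add_sub_cancel' hi] at this
      exact this
    have hinj : Function.Injective fun j : Fin 23 => α ^ (3 ^ j.val % 47) := by
      intro i j hij
      have key : ∀ i j : Fin 23, 3 ^ i.val % 47 = 3 ^ j.val % 47 → i = j := by decide +kernel
      exact key i j (hα.pow_inj (Nat.mod_lt _ (by norm_num)) (Nat.mod_lt _ (by norm_num)) hij)
    have h2 := Matrix.eq_zero_of_forall_index_sum_pow_mul_eq_zero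
      (v := fun i : Fin 23 => algebraMap (ZMod 3) (AlgebraicClosure (ZMod 3))
        (c (some ((i.val : ℕ) : ZMod 47)))) hinj (by
        intro j
        -- 3 is a square modulo 47, namely 12².
        have h3 := hc.1 (3 ^ j.val) (pow_ne_zero _ (by decide))
          (IsSquare.pow _ ⟨12, by decide⟩)
        rw [pow_val_three_pow hα.pow_eq_one] at h3
        rw [← pow_eq_pow_mod _ hα.pow_eq_one]
        have h4 : ∑ i : ZMod 47, algebraMap (ZMod 3) (AlgebraicClosure (ZMod 3))
            (c (some ((i.val : ℕ) : ZMod 47))) * (α ^ 3 ^ j.val) ^ i.val = 0 := by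
          simpa only [ZMod.natCast_zmod_val] using h3
        have h5 := (Fin.sum_univ_eq_sum_range (fun i => algebraMap (ZMod 3)
          (AlgebraicClosure (ZMod 3)) (c (some (i : ZMod 47))) * (α ^ 3 ^ j.val) ^ i) 47).symm.trans h4
        rw [← Finset.sum_subset (Finset.range_subset_range.2 (show 23 ≤ 47 by norm_num))] at h5
        · rw [← h5, ← Fin.sum_univ_eq_sum_range]
          exact Finset.sum_congr rfl fun i _ => mul_comm _ _
        · intro i hi hi'
          rw [h1 i (by simpa using hi') (by simpa using hi)]
          simp)
    have h6 : ∀ i, c (some i) = 0 := by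
      intro i
      rcases lt_or_ge i.val 23 with hi | hi
      · have := congrFun h2 ⟨i.val, hi⟩
        simpa using this
      · simpa using h1 i.val hi i.val_lt
    ext k
    rcases k with _ | i
    · change c none = 0
      rw [hc.2]
      simp [h6]
    · exact h6 i
  simpa using LinearMap.finrank_le_finrank_of_injective hf

theorem codeEquiv_Q48_of_pow_eq {ζ : L} (hζ : IsPrimitiveRoot ζ 23)
    (hr : ζ ^ 11 = listEval ζ rootL) (hα : IsPrimitiveRoot α 47)
    (hr' : α ^ 23 = listEval α rootL') :
    CodeEquiv (codeOfParameter ζ (listEval ζ betaL)) (Q48 α) := by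
  set e := (Equiv.ofBijective qrCoord qrCoord_bijective).symm with he
  have hcard : 24 = Module.finrank (ZMod 3) (Submodule.span (ZMod 3)
      (Set.range fun k : Fin 24 => qrWord (23 + k.val))) :=
    le_finrank_span_of_systematic (κ := Fin 24) _
      (fun j => some ((23 + j.val : ℕ) : ZMod 47)) (by decide +kernel)
  refine (codeEquiv_of_le_of_finrank (monomialEquiv e fun _ => 1) (isMonomial_monomialEquiv _ _)
    (Submodule.span_le.2 ?_) (fun c hc => ?_) (hcard ▸ finrank_Q48_le hα)
    (hcard ▸ finrank_codeOfParameter_le ζ _)).symm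
  · rintro _ ⟨k, rfl⟩
    exact qrWord_mem hα.pow_eq_one hr' k
  · suffices h : Submodule.span (ZMod 3) (Set.range fun k : Fin 24 => qrWord (23 + k.val)) ≤
        (codeOfParameter ζ (listEval ζ betaL)).comap (monomialEquiv e fun _ => 1).toLinearMap from
      h hc
    refine Submodule.span_le.2 ?_
    rintro _ ⟨k, rfl⟩
    change monomialEquiv e (fun _ => 1) (qrWord (23 + k.val)) ∈ codeOfParameter ζ (listEval ζ betaL)
    have h1 : monomialEquiv e (fun _ => 1) (qrWord (23 + k.val)) =
        listWord (qrBlockL 1 (23 + k.val)) (qrBlockL 46 (23 + k.val)) := by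
      ext x
      rw [← qrWord_qrCoord]
      simp [he]
    have h := checkQR_eq_true k
    simp only [checkQR, Bool.and_eq_true] at h
    rw [h1]
    exact listWord_mem hζ hr (by simp [qrBlockL]) (by simp [qrBlockL])
      ((isPrimitiveRoot_beta hr).ne_zero (by norm_num)) h.1.1.2

theorem codeEquiv_Q48 {ζ : L} (hζ : IsPrimitiveRoot ζ 23)
    (hr : ζ ^ 11 = listEval ζ rootL) (hα : IsPrimitiveRoot α 47) :
    CodeEquiv (codeOfParameter ζ (listEval ζ betaL)) (Q48 α) := by
  rcases pow_twentythree_eq_or hα with h | h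
  · exact codeEquiv_Q48_of_pow_eq hζ hr hα h
  · exact (codeEquiv_Q48_of_pow_eq hζ hr hα.inv h).trans
      (codeEquiv_Q48_inv hα.pow_eq_one).symm

end QuadraticResidue

/-! ### Reduction of the parameter to 1 and β^(2^m), 0 ≤ m < 175. -/

section Classification

theorem exists_mem_low_weight_of_codeEquiv {F : Type*} [Field F] [DecidableEq F] {ι κ : Type*}
    [Fintype ι] [Fintype κ] {C : Submodule F (ι → F)} {D : Submodule F (κ → F)}
    (h : CodeEquiv C D) {n : ℕ} (hC : ∃ c ∈ C, c ≠ 0 ∧ hammingNorm c < n) :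
    ∃ c ∈ D, c ≠ 0 ∧ hammingNorm c < n := by
  obtain ⟨f, hf, rfl⟩ := h
  obtain ⟨c, hc, h0, hn⟩ := hC
  refine ⟨f c, Submodule.mem_map_of_mem hc, by simpa using h0, ?_⟩
  rwa [hammingNorm_eq_of_isMonomial hf]

theorem le_hammingNorm_of_le_minDist {F : Type*} [Field F] [DecidableEq F] {ι : Type*}
    [Fintype ι] {C : Submodule F (ι → F)} {n : ℕ} (h : n ≤ minDist C) {c : ι → F} (hc : c ∈ C)
    (h0 : c ≠ 0) : n ≤ hammingNorm c :=
  h.trans (Nat.sInf_le ⟨c, hc, h0, rfl⟩)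

variable {ζ : L}

theorem exists_eq_mul_pow {β : L} (hβ : IsPrimitiveRoot β 3851) {t : L} (ht : t ≠ 0) :
    ∃ (x : L) (j : ℕ), x ^ 46 = 1 ∧ t = x * β ^ j := by
  have h1 : t ^ (3 ^ 11 - 1) = 1 := by
    have := Fintype.ofFinite L
    rw [← natCard_L, Nat.card_eq_fintype_card]
    exact FiniteField.pow_card_sub_one_eq_one t ht
  -- Bézout for the coprime factors of |L*|: 3851 · 7 + 46 · 3265 = 3^11, which is 1 modulo 3^11 -
  -- 1.
  obtain ⟨j, -, hj⟩ := hβ.eq_pow_of_pow_eq_one (ξ := (t ^ 46) ^ 3265) (by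
    rw [← pow_mul, ← pow_mul, show 46 * 3265 * 3851 = (3 ^ 11 - 1) * 3265 by norm_num, pow_mul, h1,
      one_pow])
  refine ⟨(t ^ 3851) ^ 7, j, ?_, ?_⟩
  · rw [← pow_mul, ← pow_mul, show 3851 * 7 * 46 = (3 ^ 11 - 1) * 7 by norm_num, pow_mul, h1,
      one_pow]
  · rw [hj, ← pow_mul, ← pow_mul, ← pow_add,
      show 3851 * 7 + 46 * 3265 = (3 ^ 11 - 1) * 1 + 1 by norm_num, pow_succ, pow_mul, h1, one_pow,
      one_mul]

theorem codeEquiv_mul_root' (hζ : IsPrimitiveRoot ζ 23) {x : L} (hx : x ^ 46 = 1) (t : L) :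
    CodeEquiv (codeOfParameter ζ (x * t)) (codeOfParameter ζ t) := by
  have h : (x ^ 23 - 1) * (x ^ 23 + 1) = 0 := by linear_combination hx
  rcases mul_eq_zero.1 h with h | h
  · exact (codeEquiv_mul_root hζ (sub_eq_zero.1 h) t).symm
  · have hx' : (-x) ^ 23 = 1 := by linear_combination -h
    have := (codeEquiv_mul_root hζ hx' t).trans (codeEquiv_neg hζ _)
    rw [neg_mul, neg_neg] at this
    exact this.symm

theorem isPrimitiveRoot_two : IsPrimitiveRoot (2 : ZMod 3851) 3850 := by
  have hp : ∀ n : ℕ, (2 : ZMod 3851) ^ n = ((2 ^ n % 3851 : ℕ) : ZMod 3851) := fun n => by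
    rw [ZMod.natCast_mod]; push_cast; rfl
  rw [IsPrimitiveRoot.iff_orderOf]
  refine orderOf_eq_of_pow_and_pow_div_prime (by norm_num) ?_ ?_
  · rw [hp]
    decide +kernel
  · intro p hp' hd
    have h : p ∈ Nat.primeFactors 3850 := Nat.mem_primeFactors.2 ⟨hp', hd, by norm_num⟩
    have hf : Nat.primeFactors 3850 = {2, 5, 7, 11} := by
      rw [show 3850 = 2 * (5 ^ 2 * (7 * 11)) by norm_num,
        Nat.primeFactors_mul (by norm_num) (by norm_num),
        Nat.primeFactors_mul (by norm_num) (by norm_num),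
        Nat.primeFactors_mul (by norm_num) (by norm_num), Nat.primeFactors_pow _ (by norm_num),
        Nat.Prime.primeFactors (by norm_num), Nat.Prime.primeFactors (by norm_num),
        Nat.Prime.primeFactors (by norm_num), Nat.Prime.primeFactors (by norm_num)]
      rfl
    rw [hf] at h
    rw [hp]
    simp only [Finset.mem_insert, Finset.mem_singleton] at h
    rcases h with rfl | rfl | rfl | rfl <;> decide +kernel

theorem pow_eq_pow_two_pow {β : L} (hβ : β ^ 3851 = 1) {j : ℕ} (hj : ¬ 3851 ∣ j) :
    ∃ m : ℕ, β ^ j = β ^ 2 ^ m := by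
  have : Fact (Nat.Prime 3851) := ⟨by norm_num⟩
  have hj' : (j : ZMod 3851) ≠ 0 := by rwa [Ne, ZMod.natCast_eq_zero_iff]
  obtain ⟨m, -, hm⟩ := isPrimitiveRoot_two.eq_pow_of_pow_eq_one (ZMod.pow_card_sub_one_eq_one hj')
  refine ⟨m, ?_⟩
  have h : 2 ^ m ≡ j [MOD 3851] := by
    rw [← ZMod.natCast_eq_natCast_iff]
    exact_mod_cast hm
  rw [pow_eq_pow_mod j hβ, pow_eq_pow_mod (2 ^ m) hβ, h]

theorem codeEquiv_two_pow (hζ : IsPrimitiveRoot ζ 23) {β : L} (hβ : β ^ 3851 = 1) (m : ℕ) :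
    CodeEquiv (codeOfParameter ζ (β ^ 2 ^ m)) (codeOfParameter ζ (β ^ 2 ^ (m % 175))) := by
  induction m using Nat.strong_induction_on with
  | _ m ih =>
    rcases lt_or_ge m 175 with h | h
    · rw [Nat.mod_eq_of_lt h]
      exact codeEquiv_of_mem_iff (Equiv.refl _) (fun _ => 1) fun c => by
        rw [show monomialEquiv (Equiv.refl _) (fun _ => 1) c = c by ext; simp]
    · obtain ⟨m, rfl⟩ := Nat.exists_eq_add_of_le' h
      rw [Nat.add_mod_right]
      refine CodeEquiv.trans ?_ (ih m (by omega))
      set γ := β ^ 2 ^ m with hγ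
      have hγ1 : γ ^ 3851 = 1 := by rw [hγ, ← pow_mul, mul_comm, pow_mul, hβ, one_pow]
      have hγ0 : γ ≠ 0 := by
        intro h0
        rw [h0] at hγ1
        simp at hγ1
      -- 2^175 ≡ -3 modulo 3851, so 175 squarings of γ amount to cubing and inverting.
      have h1 : β ^ 2 ^ (m + 175) = (γ ^ 3)⁻¹ := by
        refine eq_inv_of_mul_eq_one_left ?_
        rw [pow_add, pow_mul, ← hγ, ← pow_add,
          show 2 ^ 175 + 3 = 3851 * ((2 ^ 175 + 3) / 3851) by norm_num, pow_mul, hγ1, one_pow]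
      rw [h1]
      exact ((codeEquiv_pow_three hζ γ).trans (codeEquiv_inv hζ (pow_ne_zero 3 hγ0))).symm

theorem codeEquiv_P48_or_Q48_of_pow_eq {α : AlgebraicClosure (ZMod 3)} (hα : IsPrimitiveRoot α 47)
    (hζ : IsPrimitiveRoot ζ 23) (hr : ζ ^ 11 = listEval ζ rootL) {t : L} (ht : t ≠ 0)
    (hw : ∀ c ∈ codeOfParameter ζ t, c ≠ 0 → 15 ≤ hammingNorm c) :
    CodeEquiv (codeOfParameter ζ t) P48 ∨ CodeEquiv (codeOfParameter ζ t) (Q48 α) := by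
  have hβ := isPrimitiveRoot_beta hr
  obtain ⟨x, j, hx, rfl⟩ := exists_eq_mul_pow hβ ht
  have h1 := codeEquiv_mul_root' hζ hx (listEval ζ betaL ^ j)
  by_cases hj : 3851 ∣ j
  · rw [(hβ.pow_eq_one_iff_dvd j).2 hj] at h1 ⊢
    exact Or.inl (h1.trans (codeEquiv_P48 hζ hr))
  · obtain ⟨m, hm⟩ := pow_eq_pow_two_pow hβ.pow_eq_one hj
    rw [hm] at h1 hw ⊢
    have h2 := h1.trans (codeEquiv_two_pow hζ hβ.pow_eq_one m)
    rcases Nat.eq_zero_or_pos (m % 175) with h0 | h0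
    · rw [h0, pow_zero, pow_one] at h2
      exact Or.inr (h2.trans (codeEquiv_Q48 hζ hr hα))
    · obtain ⟨c, hc, hc0, hcw⟩ := exists_mem_low_weight_of_codeEquiv h2.symm
        (exists_low_weight hζ hr h0 (Nat.mod_lt m (by norm_num)))
      exact absurd (hw c hc hc0) (not_le.2 hcw)

theorem codeEquiv_P48_or_Q48 {α : AlgebraicClosure (ZMod 3)} (hα : IsPrimitiveRoot α 47)
    (hζ : IsPrimitiveRoot ζ 23) {t : L} (ht : t ≠ 0)
    (hw : ∀ c ∈ codeOfParameter ζ t, c ≠ 0 → 15 ≤ hammingNorm c) :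
    CodeEquiv (codeOfParameter ζ t) P48 ∨ CodeEquiv (codeOfParameter ζ t) (Q48 α) := by
  rcases pow_eleven_eq_or hζ with hr | hr
  · exact codeEquiv_P48_or_Q48_of_pow_eq hα hζ hr ht hw
  · rw [← codeOfParameter_inv] at hw ⊢
    exact codeEquiv_P48_or_Q48_of_pow_eq hα hζ.inv hr (neg_ne_zero.2 (inv_ne_zero ht)) hw

end Classification

/-! ### ζ generates L and is conjugate neither to ζ⁻¹ nor to 1. -/

section FieldGeneration

variable {ζ : L}

theorem adjoin_root_eq_top (hζ : IsPrimitiveRoot ζ 23) : Algebra.adjoin (ZMod 3) {ζ} = ⊤ := by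
  have := Subalgebra.isSimpleOrder_of_finrank_prime (ZMod 3) L (by rw [finrank_L]; norm_num)
  refine (eq_bot_or_eq_top _).resolve_left fun h => ?_
  have h1 : ζ ∈ (⊥ : Subalgebra (ZMod 3) L) := h ▸ Algebra.subset_adjoin rfl
  obtain ⟨x, hx⟩ := Algebra.mem_bot.1 h1
  have h2 : ζ ^ 3 = ζ := by rw [← hx, ← map_pow, ZMod.pow_card]
  have h3 : ζ ^ 2 = 1 := by
    have h0 : ζ ≠ 0 := hζ.ne_zero (by norm_num)
    apply mul_left_cancel₀ h0
    linear_combination h2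
  have := (hζ.pow_eq_one_iff_dvd 2).1 h3
  omega

theorem exists_algEquiv_of_aeval_minpoly_eq_zero (ζ : L) {y : L}
    (h : Polynomial.aeval y (minpoly (ZMod 3) ζ) = 0) : ∃ φ : L ≃ₐ[ZMod 3] L, φ ζ = y := by
  have hi : IsIntegral (ZMod 3) ζ := Algebra.IsIntegral.isIntegral ζ
  have h1 := minpoly.eq_of_irreducible_of_monic (minpoly.irreducible hi) h (minpoly.monic hi)
  obtain ⟨φ, hφ⟩ := (Normal.minpoly_eq_iff_mem_orbit (F := ZMod 3) (E := L)).1 h1.symm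
  exact ⟨φ, hφ⟩

/-- An automorphism taking ζ to ζ⁻¹ has a square fixing ζ; as the Galois group has odd order 11, it
would fix ζ itself, forcing ζ² = 1. -/
theorem aeval_inv_minpoly_ne_zero (hζ : IsPrimitiveRoot ζ 23) :
    Polynomial.aeval ζ⁻¹ (minpoly (ZMod 3) ζ) ≠ 0 := by
  intro h
  obtain ⟨φ, hφ⟩ := exists_algEquiv_of_aeval_minpoly_eq_zero ζ h
  have h2 : (φ ^ 2) ζ = ζ := by
    rw [sq, AlgEquiv.mul_apply, hφ, map_inv₀, hφ, inv_inv]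
  have h11 : φ ^ 11 = 1 := by
    have hc := IsGalois.card_aut_eq_finrank (ZMod 3) L
    rw [finrank_L] at hc
    have h := pow_card_eq_one' (x := φ)
    rwa [hc] at h
  have h10 : ∀ n : ℕ, ((φ ^ 2) ^ n) ζ = ζ := by
    intro n
    induction n with
    | zero => rfl
    | succ n ih => rw [pow_succ, AlgEquiv.mul_apply, h2, ih]
  have h3 : ζ⁻¹ = ζ := by
    have : (φ ^ 11) ζ = ζ⁻¹ := by
      rw [show φ ^ 11 = φ * (φ ^ 2) ^ 5 by group, AlgEquiv.mul_apply, h10, hφ]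
    rw [← this, h11]
    rfl
  have h0 : ζ ≠ 0 := hζ.ne_zero (by norm_num)
  have h4 : ζ ^ 2 = 1 := by
    rw [sq]
    nth_rewrite 1 [← h3]
    exact inv_mul_cancel₀ h0
  have := (hζ.pow_eq_one_iff_dvd 2).1 h4
  omega

theorem eval_one_minpoly_ne_zero (hζ : IsPrimitiveRoot ζ 23) :
    Polynomial.eval 1 (minpoly (ZMod 3) ζ) ≠ 0 := by
  intro h
  obtain ⟨φ, hφ⟩ := exists_algEquiv_of_aeval_minpoly_eq_zero ζ (y := 1) (by
    rw [← map_one (algebraMap (ZMod 3) L), Polynomial.aeval_algebraMap_apply,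
      Polynomial.coe_aeval_eq_eval, h, map_zero])
  exact hζ.ne_one (by norm_num) (φ.injective (hφ.trans (map_one φ).symm))

end FieldGeneration

/-! ### The block shift acting on the components. -/

section Shift

variable {ζ : L}

@[simp]
theorem blockShift_inl (c : Coord → ZMod 3) (b : Fin 2) (i : ZMod 23) :
    blockShift c (Sum.inl (b, i)) = c (Sum.inl (b, i - 1)) := rfl

@[simp]
theorem blockShift_inr (c : Coord → ZMod 3) (b : Fin 2) :
    blockShift c (Sum.inr b) = c (Sum.inr b) := rfl

theorem blockShift_pow_inl (n : ℕ) (c : Coord → ZMod 3) (b : Fin 2) (i : ZMod 23) :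
    (blockShift ^ n) c (Sum.inl (b, i)) = c (Sum.inl (b, i - n)) := by
  induction n generalizing i with
  | zero => simp
  | succ n ih =>
    rw [pow_succ', LinearEquiv.mul_apply, blockShift_inl, ih]
    congr 3
    push_cast
    ring

theorem blockShift_pow_inr (n : ℕ) (c : Coord → ZMod 3) (b : Fin 2) :
    (blockShift ^ n) c (Sum.inr b) = c (Sum.inr b) := by
  induction n with
  | zero => simp
  | succ n ih => rw [pow_succ', LinearEquiv.mul_apply, blockShift_inr, ih]

theorem blockShift_traceWord (hζ : IsPrimitiveRoot ζ 23) (a : Fin 2 → L) :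
    blockShift (traceWord ζ a) = traceWord ζ (ζ • a) := by
  have h0 : ζ ≠ 0 := hζ.ne_zero (by norm_num)
  ext (⟨b, i⟩ | b)
  · rw [blockShift_inl, traceWord_inl, traceWord_inl, inv_pow_val hζ.pow_eq_one,
      inv_pow_val hζ.pow_eq_one, neg_sub, sub_eq_add_neg, pow_val_add hζ.pow_eq_one]
    have : (1 : ZMod 23).val = 1 := rfl
    rw [this, Pi.smul_apply, smul_eq_mul]
    ring_nf
  · rfl

theorem fourier_block_blockShift {ξ : L} (hξ : ξ ^ 23 = 1) (b : Fin 2) (c : Coord → ZMod 3) :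
    fourier ξ (block b (blockShift c)) = ξ * fourier ξ (block b c) := by
  have := fourier_shift hξ (block b c) 1
  rwa [show (1 : ZMod 23).val = 1 from rfl, pow_one] at this

open Polynomial in
theorem fourier_block_aeval {ξ : L} (hξ : ξ ^ 23 = 1) (b : Fin 2) (c : Coord → ZMod 3)
    (p : Polynomial (ZMod 3)) :
    fourier ξ (block b (aeval (blockShift.toLinearMap : Module.End (ZMod 3) _) p c)) =
      aeval ξ p * fourier ξ (block b c) := by
  induction p using Polynomial.induction_on generalizing c with
  | C a => rw [aeval_C, Module.algebraMap_end_apply, map_smul, map_smul, aeval_C, Algebra.smul_def]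
  | add p q hp hq => simp [hp, hq, add_mul]
  | monomial n a ih =>
    have h : aeval ξ (C a * X ^ n * X) = aeval ξ (C a * X ^ n) * ξ := by rw [map_mul, aeval_X]
    rw [pow_succ, ← mul_assoc, h, map_mul, Module.End.mul_apply, ih, aeval_X,
      LinearEquiv.coe_coe, fourier_block_blockShift hξ, mul_assoc]

open Polynomial in
theorem aeval_blockShift_inr (b : Fin 2) (c : Coord → ZMod 3) (p : Polynomial (ZMod 3)) :
    aeval (blockShift.toLinearMap : Module.End (ZMod 3) _) p c (Sum.inr b) =
      eval 1 p * c (Sum.inr b) := by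
  induction p using Polynomial.induction_on generalizing c with
  | C a => simp
  | add p q hp hq => simp [hp, hq, add_mul]
  | monomial n a ih =>
    rw [pow_succ, ← mul_assoc, map_mul, Module.End.mul_apply, ih, aeval_X, LinearEquiv.coe_coe,
      blockShift_inr]
    simp

open Polynomial in
theorem aeval_blockShift_traceWord (hζ : IsPrimitiveRoot ζ 23) (a : Fin 2 → L)
    (p : Polynomial (ZMod 3)) :
    aeval (blockShift.toLinearMap : Module.End (ZMod 3) _) p (traceWord ζ a) =
      traceWord ζ (aeval ζ p • a) := by
  induction p using Polynomial.induction_on generalizing a with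
  | C x => simp
  | add p q hp hq => simp [hp, hq, add_smul]
  | monomial n x ih =>
    have h : aeval ζ (C x * X ^ n * X) = aeval ζ (C x * X ^ n) * ζ := by rw [map_mul, aeval_X]
    rw [pow_succ, ← mul_assoc, h, map_mul, Module.End.mul_apply, aeval_X, LinearEquiv.coe_coe,
      blockShift_traceWord hζ, ih, mul_smul]

/-- A polynomial q in the shift multiplies the Fourier coefficient at ξ by q(ξ). The minimal
polynomial of ζ is nonzero at 1 and ζ⁻¹, so its kernel retains only the ζ-part. -/
theorem eigenComponent_codeOfParameter (hζ : IsPrimitiveRoot ζ 23) (t : L) :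
    eigenComponent blockShift (codeOfParameter ζ t) (minpoly (ZMod 3) ζ) = eigenCode ζ t := by
  ext c
  rw [eigenComponent, Submodule.mem_inf, LinearMap.mem_ker]
  constructor
  · rintro ⟨hc, h⟩
    rw [mem_codeOfParameter hζ] at hc
    have h1 : ∀ b, c (Sum.inr b) = 0 := fun b => by
      have := aeval_blockShift_inr b c (minpoly (ZMod 3) ζ)
      rw [h] at this
      exact (mul_eq_zero.1 this.symm).resolve_left (eval_one_minpoly_ne_zero hζ)
    have h2 : ∀ b, fourier ζ⁻¹ (block b c) = 0 := fun b => by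
      have := fourier_block_aeval hζ.inv.pow_eq_one b c (minpoly (ZMod 3) ζ)
      rw [h, map_zero, map_zero] at this
      exact (mul_eq_zero.1 this.symm).resolve_left (aeval_inv_minpoly_ne_zero hζ)
    refine mem_eigenCode.2 ⟨-fourier ζ (block 0 c), ?_⟩
    have h3 := eq_constantPart_add_traceWord hζ hc.1
    have h4 : constantPart c = 0 := by ext (k | k) <;> simp [constantPart, h1]
    have h5 : (fun b => -fourier ζ⁻¹ (block b c)) = (0 : Fin 2 → L) := by ext b; simp [h2]
    rw [h4, h5, map_zero, add_zero, zero_add] at h3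
    conv_rhs => rw [h3]
    congr 1
    ext b
    fin_cases b <;> simp [hc.2.1]
  · intro h
    refine ⟨Submodule.mem_sup_left (Submodule.mem_sup_right h), ?_⟩
    obtain ⟨a, rfl⟩ := mem_eigenCode.1 h
    rw [aeval_blockShift_traceWord hζ, minpoly.aeval, zero_smul, map_zero]

/-- Up to sign, the ζ- and ζ⁻¹-components are paired by the trace form of L; this is how
self-orthogonality relates the two parameters. -/
theorem trace_pairing (hζ : IsPrimitiveRoot ζ 23) (a b : L) :
    ∑ i : ZMod 23, Algebra.trace (ZMod 3) L (a * ζ⁻¹ ^ i.val) *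
      Algebra.trace (ZMod 3) L (b * ζ ^ i.val) = -Algebra.trace (ZMod 3) L (a * b) := by
  have h := fourier_trace_self hζ a
  rw [← neg_eq_iff_eq_neg] at h
  conv_rhs => rw [← h, neg_mul, map_neg, neg_neg, fourier_apply, Finset.sum_mul, map_sum]
  refine Finset.sum_congr rfl fun i _ => ?_
  rw [mul_assoc, ← Algebra.smul_def, map_smul, smul_eq_mul, mul_comm b]

end Shift

/-! ### Shift-invariant extremal codes are determined by their components. -/

section Structure

/-- Self-orthogonal codes of dimension 24 and minimum distance at least 15 that are invariant under
the block shift. -/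
structure IsShiftInvariantExtremal (C : Submodule (ZMod 3) (Coord → ZMod 3)) : Prop where
  shift : ∀ c ∈ C, blockShift c ∈ C
  orthogonal : ∀ x ∈ C, ∀ y ∈ C, ∑ k, x k * y k = 0
  finrank_eq : Module.finrank (ZMod 3) C = 24
  weight : ∀ c ∈ C, c ≠ 0 → 15 ≤ hammingNorm c

theorem sum_mul_eq_of_isMonomial {ι κ : Type*} [Fintype ι] [Fintype κ]
    {f : (ι → ZMod 3) ≃ₗ[ZMod 3] (κ → ZMod 3)} (hf : IsMonomial f) (x y : ι → ZMod 3) :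
    ∑ k, f x k * f y k = ∑ i, x i * y i := by
  obtain ⟨e, u, h⟩ := hf
  rw [← Equiv.sum_comp e.symm]
  refine Finset.sum_congr rfl fun k _ => ?_
  have hu : ∀ v : (ZMod 3)ˣ, (v : ZMod 3) * v = 1 := by decide
  rw [h, h, mul_mul_mul_comm, hu, one_mul]

/-- A vector of weight at most `n` in a subspace of dimension greater than the number of the
remaining coordinates. -/
theorem exists_ne_zero_vanishing {F : Type*} [Field F] {ι : Type*} [Finite ι]
    (W : Submodule F (ι → F)) (T : Finset ι) (h : T.card < Module.finrank F W) :
    ∃ w ∈ W, w ≠ 0 ∧ ∀ i ∈ T, w i = 0 := by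
  have hlt : Module.finrank F (T → F) < Module.finrank F W := by simpa using h
  obtain ⟨w, hw, hw0⟩ := (Submodule.ne_bot_iff _).1 (LinearMap.ker_ne_bot_of_finrank_lt
    (f := LinearMap.funLeft F F (fun i : T => (i : ι)) ∘ₗ W.subtype) hlt)
  exact ⟨w, w.2, by simpa using hw0, fun i hi => congrFun (LinearMap.mem_ker.1 hw) ⟨i, hi⟩⟩

theorem hammingNorm_le_of_vanishing {F : Type*} [Zero F] [DecidableEq F] {ι : Type*} [Fintype ι]
    {w : ι → F} {T : Finset ι} (h : ∀ i ∉ T, w i = 0) : hammingNorm w ≤ T.card := by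
  refine Finset.card_le_card fun i hi => ?_
  by_contra hT
  exact (Finset.mem_filter.1 hi).2 (h i hT)

variable {C : Submodule (ZMod 3) (Coord → ZMod 3)} {ζ : L}

namespace IsShiftInvariantExtremal

theorem eq_zero_of_blocks_eq_zero (hC : IsShiftInvariantExtremal C) {c : Coord → ZMod 3}
    (hc : c ∈ C) (h : ∀ b i, c (Sum.inl (b, i)) = 0) : c = 0 := by
  by_contra h0
  have h1 := hC.weight c hc h0
  have h2 : hammingNorm c ≤ (Finset.univ.map Function.Embedding.inr : Finset Coord).card :=
    hammingNorm_le_of_vanishing fun k hk => by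
      rcases k with ⟨b, i⟩ | j
      · exact h b i
      · simp at hk
  simp at h2
  omega

theorem pow_mem (hC : IsShiftInvariantExtremal C) {c : Coord → ZMod 3} (hc : c ∈ C) (n : ℕ) :
    (blockShift ^ n) c ∈ C := by
  induction n with
  | zero => simpa using hc
  | succ n ih => rw [pow_succ']; exact hC.shift _ ih

/-- The average of a codeword over the block shift. -/
theorem average_mem (hC : IsShiftInvariantExtremal C) {c : Coord → ZMod 3} (hc : c ∈ C) :
    (Sum.elim (fun k => -∑ i, block k.1 c i) fun b => c (Sum.inr b) : Coord → ZMod 3) ∈ C := by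
  have h : -∑ i : ZMod 23, (blockShift ^ i.val) c ∈ C :=
    Submodule.neg_mem _ (Submodule.sum_mem _ fun i _ => hC.pow_mem hc _)
  convert h using 1
  ext (⟨b, i⟩ | b)
  · simp only [Sum.elim_inl, block_apply, Pi.neg_apply, Finset.sum_apply, blockShift_pow_inl,
      ZMod.natCast_val, ZMod.cast_id', id]
    exact congrArg _ (Equiv.sum_comp (Equiv.subLeft i) fun j => c (Sum.inl (b, j))).symm
  · simp only [Sum.elim_inr, Pi.neg_apply, Finset.sum_apply, blockShift_pow_inr, Finset.sum_const,
      Finset.card_univ, ZMod.card, nsmul_eq_mul]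
    have : ((23 : ℕ) : ZMod 3) = -1 := by decide
    rw [this]
    ring

/-- The combination of shifts with coefficients Tr(ζ^(-i)) is, up to sign, the primitive idempotent
belonging to ζ. -/
theorem traceWord_fourier_mem (hC : IsShiftInvariantExtremal C) (hζ : IsPrimitiveRoot ζ 23)
    {c : Coord → ZMod 3} (hc : c ∈ C) : traceWord ζ (fun b => fourier ζ (block b c)) ∈ C := by
  have h : ∑ i : ZMod 23, Algebra.trace (ZMod 3) L (ζ⁻¹ ^ i.val) • (blockShift ^ i.val) c ∈ C :=
    Submodule.sum_mem _ fun i _ => Submodule.smul_mem _ _ (hC.pow_mem hc _)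
  convert h using 1
  ext (⟨b, i⟩ | b)
  · simp only [traceWord_inl, Finset.sum_apply, Pi.smul_apply, blockShift_pow_inl,
      ZMod.natCast_val, ZMod.cast_id', id, smul_eq_mul, fourier_apply, block_apply]
    rw [Finset.sum_mul, map_sum, ← Equiv.sum_comp (Equiv.subLeft i)]
    refine Finset.sum_congr rfl fun j _ => ?_
    rw [mul_assoc, ← Algebra.smul_def, map_smul, smul_eq_mul, mul_comm, Equiv.subLeft_apply,
      inv_pow_val hζ.pow_eq_one, inv_pow_val hζ.pow_eq_one, ← pow_val_add hζ.pow_eq_one]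
    congr 3
    ring_nf
  · simp only [traceWord_inr, Finset.sum_apply, Pi.smul_apply, blockShift_pow_inr, smul_eq_mul]
    rw [← Finset.sum_mul]
    have := sum_trace hζ.inv 1
    simp only [one_mul] at this
    rw [this, zero_mul]

theorem traceWord_smul_mem (hC : IsShiftInvariantExtremal C) (hζ : IsPrimitiveRoot ζ 23)
    {a : Fin 2 → L} (ha : traceWord ζ a ∈ C) (s : L) : traceWord ζ (s • a) ∈ C := by
  have hs : s ∈ Algebra.adjoin (ZMod 3) {ζ} := by rw [adjoin_root_eq_top hζ]; trivial
  induction hs using Algebra.adjoin_induction generalizing a with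
  | mem x hx =>
    rw [Set.mem_singleton_iff.1 hx, ← blockShift_traceWord hζ]
    exact hC.shift _ ha
  | algebraMap r =>
    rw [algebraMap_smul, map_smul]
    exact Submodule.smul_mem _ _ ha
  | add x y _ _ hx hy =>
    rw [add_smul, map_add]
    exact Submodule.add_mem _ (hx ha) (hy ha)
  | mul x y _ _ hx hy =>
    rw [mul_smul]
    exact hx (hy ha)

/-- If one entry vanishes, all L-multiples live on a single block. Ten linear conditions on the
11-dimensional L leave a nonzero multiple vanishing at 10 of the 23 positions, of weight at most 13
< 15. -/
theorem eq_zero_of_traceWord_mem (hC : IsShiftInvariantExtremal C) (hζ : IsPrimitiveRoot ζ 23)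
    {a : Fin 2 → L} (ha : traceWord ζ a ∈ C) {b : Fin 2} (hb : a b = 0) : a = 0 := by
  have hfin : ∀ b : Fin 2, ∃ b', ∀ d, d = b ∨ d = b' := by decide
  obtain ⟨b', hb'⟩ := hfin b
  by_contra h0
  have h1 : a b' ≠ 0 := by
    intro h
    apply h0
    ext d
    rcases hb' d with rfl | rfl <;> assumption
  let f : L →ₗ[ZMod 3] (Fin 10 → ZMod 3) := LinearMap.pi fun j =>
    Algebra.trace (ZMod 3) L ∘ₗ LinearMap.mulRight (ZMod 3) (a b' * ζ⁻¹ ^ j.val)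
  obtain ⟨s, hs, hs0⟩ := (Submodule.ne_bot_iff _).1 (LinearMap.ker_ne_bot_of_finrank_lt (f := f)
    (by rw [finrank_L]; simp))
  have hs' : ∀ i : ZMod 23, i.val < 10 →
      Algebra.trace (ZMod 3) L (s * a b' * ζ⁻¹ ^ i.val) = 0 := by
    intro i hi
    have := congrFun (LinearMap.mem_ker.1 hs) ⟨i.val, hi⟩
    simp only [f, LinearMap.pi_apply, LinearMap.comp_apply, LinearMap.mulRight_apply,
      Pi.zero_apply] at this
    rwa [mul_assoc]
  have h2 : traceWord ζ (s • a) ≠ 0 := by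
    intro h
    have := fourier_block_traceWord hζ (s • a) b'
    rw [h] at this
    simp [hs0, h1] at this
  have h3 := hC.weight _ (hC.traceWord_smul_mem hζ ha s) h2
  have h4 : hammingNorm (traceWord ζ (s • a)) ≤
      ((Finset.univ.filter fun i : ZMod 23 => 10 ≤ i.val).image
        fun i => (Sum.inl (b', i) : Coord)).card := by
    refine hammingNorm_le_of_vanishing fun k hk => ?_
    rcases k with ⟨d, i⟩ | j
    · rw [traceWord_inl]
      by_cases hd : d = b'
      · subst hd
        refine hs' i ?_
        by_contra hi
        exact hk (Finset.mem_image.2 ⟨i, by simpa using hi, rfl⟩)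
      · rw [(hb' d).resolve_right hd, Pi.smul_apply, hb]
        simp
    · rfl
  have h5 := h4.trans Finset.card_image_le
  have h6 : (Finset.univ.filter fun i : ZMod 23 => 10 ≤ i.val).card = 13 := by decide +kernel
  omega

/-- The data that determine a codeword. -/
noncomputable def invariants (C : Submodule (ZMod 3) (Coord → ZMod 3)) (ζ : L) :
    C →ₗ[ZMod 3] (Fin 2 → ZMod 3) × L × L where
  toFun c := (fun b => -∑ i, block b c i, fourier ζ (block 0 c), fourier ζ⁻¹ (block 0 c))
  map_add' c d := by
    simp only [Submodule.coe_add, map_add, Pi.add_apply, Finset.sum_add_distrib, neg_add]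
    rfl
  map_smul' s c := by
    simp only [Submodule.coe_smul, map_smul, Pi.smul_apply, ← Finset.smul_sum, ← smul_neg]
    rfl

theorem invariants_apply {c : Coord → ZMod 3} (hc : c ∈ C) : invariants C ζ ⟨c, hc⟩ =
    (fun b => -∑ i, block b c i, fourier ζ (block 0 c), fourier ζ⁻¹ (block 0 c)) := rfl

/-- If the invariants vanish, the averaged word and both L-components are zero by the weight bound.
Injectivity and 24 = 2 + 11 + 11 then give surjectivity. -/
theorem invariants_surjective (hC : IsShiftInvariantExtremal C) (hζ : IsPrimitiveRoot ζ 23) :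
    Function.Surjective (invariants C ζ) := by
  have hi : Function.Injective (invariants C ζ) := by
    rw [injective_iff_map_eq_zero]
    rintro ⟨c, hc⟩ h
    rw [invariants_apply, Prod.mk_eq_zero, Prod.mk_eq_zero] at h
    obtain ⟨h1, h2, h3⟩ := h
    have h1' : ∀ b, -∑ i, block b c i = 0 := congrFun h1
    have h4 := hC.eq_zero_of_blocks_eq_zero (hC.average_mem hc) (fun b _ => h1' b)
    have h5 : ∀ b, c (Sum.inr b) = 0 := fun b => congrFun h4 (Sum.inr b)
    have h6 := hC.eq_zero_of_traceWord_mem hζ (hC.traceWord_fourier_mem hζ hc) (b := 0) h2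
    have h7 := hC.eq_zero_of_traceWord_mem hζ.inv (hC.traceWord_fourier_mem hζ.inv hc) (b := 0) h3
    have h8 := eq_constantPart_add_traceWord hζ (c := c) fun b => by rw [h5, h1']
    have h9 : constantPart c = 0 := by ext (k | k) <;> simp [constantPart, h5]
    have e1 : (fun b => -fourier ζ (block b c)) = (0 : Fin 2 → L) := by
      ext b; simpa using congrFun h6 b
    have e2 : (fun b => -fourier ζ⁻¹ (block b c)) = (0 : Fin 2 → L) := by
      ext b; simpa using congrFun h7 b
    rw [h9, e1, e2, map_zero, map_zero, add_zero, add_zero] at h8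
    exact Subtype.ext h8
  refine (LinearMap.injective_iff_surjective_of_finrank_eq_finrank ?_).1 hi
  rw [hC.finrank_eq, Module.finrank_prod, Module.finrank_prod, finrank_L]
  simp

theorem exists_parameter (hC : IsShiftInvariantExtremal C) (hζ : IsPrimitiveRoot ζ 23) :
    ∃ t : L, t ≠ 0 ∧ traceWord ζ ![1, t] ∈ C ∧ traceWord ζ⁻¹ ![1, -t⁻¹] ∈ C := by
  obtain ⟨⟨c, hc⟩, h⟩ := hC.invariants_surjective hζ (0, 1, 1)
  rw [invariants_apply, Prod.mk.injEq, Prod.mk.injEq] at h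
  obtain ⟨-, h3, h4⟩ := h
  have h1 := hC.traceWord_fourier_mem hζ hc
  have h2 := hC.traceWord_fourier_mem hζ.inv hc
  set t := fourier ζ (block 1 c)
  set t' := fourier ζ⁻¹ (block 1 c)
  have e1 : (fun b => fourier ζ (block b c)) = ![1, t] := by
    ext b; fin_cases b
    · exact h3
    · rfl
  have e2 : (fun b => fourier ζ⁻¹ (block b c)) = ![1, t'] := by
    ext b; fin_cases b
    · exact h4
    · rfl
  rw [e1] at h1
  rw [e2] at h2
  have ht : t ≠ 0 := by
    intro h0
    have := hC.eq_zero_of_traceWord_mem hζ h1 (b := 1) h0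
    exact one_ne_zero (congrFun this 0 : (1 : L) = 0)
  -- Orthogonality of (1, t) to all L-multiples of (1, t') gives Tr((1 + tt')s) = 0 for every s, and
  -- the trace form is nondegenerate.
  have htt : 1 + t * t' = 0 := by
    by_contra hne
    obtain ⟨s, hs⟩ : ∃ s, Algebra.trace (ZMod 3) L ((1 + t * t') * s) ≠ 0 := by
      by_contra! hf
      exact hne ((traceForm_nondegenerate (ZMod 3) L).1 _ hf)
    apply hs
    have h3 := hC.orthogonal _ h1 _ (hC.traceWord_smul_mem hζ.inv h2 s)
    rw [Fintype.sum_sum_type, Fintype.sum_prod_type] at h3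
    simp only [traceWord_inl, traceWord_inr, inv_inv, trace_pairing hζ, Pi.smul_apply,
      smul_eq_mul, Fin.sum_univ_two, mul_zero, add_zero, Matrix.cons_val_zero,
      Matrix.cons_val_one, one_mul, mul_one] at h3
    rw [add_mul, one_mul, map_add, show t * t' * s = t * (s * t') by ring]
    linear_combination -h3
  refine ⟨t, ht, h1, ?_⟩
  have : t' = -t⁻¹ := by
    field_simp
    linear_combination htt
  rwa [this] at h2

theorem exists_eq_codeOfParameter (hC : IsShiftInvariantExtremal C) (hζ : IsPrimitiveRoot ζ 23)
    (hF : standardFixedCode ≤ C) :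
    fixedCode blockShift C = standardFixedCode ∧ ∃ t : L, t ≠ 0 ∧ C = codeOfParameter ζ t := by
  constructor
  · refine le_antisymm ?_ fun c hc => ⟨hF hc, ?_⟩
    · rintro c ⟨hc, hs⟩
      have hs' : blockShift c = c := hs
      have h1 : ∀ b (n : ℕ), c (Sum.inl (b, (n : ZMod 23))) = c (Sum.inl (b, 0)) := by
        intro b n
        induction n with
        | zero => simp
        | succ n ih =>
          rw [← ih]
          have := congrFun hs' (Sum.inl (b, ((n + 1 : ℕ) : ZMod 23)))
          rw [blockShift_inl] at this
          rw [← this]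
          simp
      have h2 : ∀ b i, c (Sum.inl (b, i)) = c (Sum.inl (b, 0)) := fun b i => by
        simpa using h1 b i.val
      set d : Coord → ZMod 3 := Sum.elim (fun k => c (Sum.inl (k.1, 0))) fun b => c (Sum.inl (b, 0))
      have hd : d ∈ standardFixedCode := by
        rw [mem_standardFixedCode]; intro b i; rfl
      have h3 := hC.eq_zero_of_blocks_eq_zero (Submodule.sub_mem _ hc (hF hd)) fun b i => by
        rw [Pi.sub_apply, h2]
        simp [d]
      rwa [sub_eq_zero.1 h3]
    · change blockShift c = c
      rw [mem_standardFixedCode] at hc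
      ext (⟨b, i⟩ | b)
      · rw [blockShift_inl, hc, hc]
      · rfl
  · obtain ⟨t, ht, h1, h2⟩ := hC.exists_parameter hζ
    refine ⟨t, ht, le_antisymm (fun c hc => ?_) ?_⟩
    · have hA : ∀ {ξ s : L}, IsPrimitiveRoot ξ 23 → traceWord ξ ![1, s] ∈ C →
          fourier ξ (block 1 c) = s * fourier ξ (block 0 c) := by
        intro ξ s hξ hs
        have h3 := Submodule.sub_mem _ (hC.traceWord_fourier_mem hξ hc)
          (hC.traceWord_smul_mem hξ hs (fourier ξ (block 0 c)))
        rw [← map_sub] at h3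
        have h4 := congrFun (hC.eq_zero_of_traceWord_mem hξ h3 (b := 0) (by simp)) 1
        simp only [Pi.sub_apply, Pi.smul_apply, Matrix.cons_val_one, Matrix.cons_val_fin_one,
          smul_eq_mul, Pi.zero_apply] at h4
        linear_combination h4
      refine (mem_codeOfParameter hζ).2 ⟨fun b => ?_, hA hζ h1, hA hζ.inv h2⟩
      have h3 := hC.average_mem hc
      set d : Coord → ZMod 3 := Sum.elim (fun k => -∑ i, block k.1 c i)
        fun b => -∑ i, block b c i with hd
      have hd' : d ∈ standardFixedCode := by
        rw [mem_standardFixedCode]; intro b i; rfl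
      have h4 := hC.eq_zero_of_blocks_eq_zero (Submodule.sub_mem _ h3 (hF hd')) fun b i => by
        simp [hd]
      have h5 := congrFun h4 (Sum.inr b)
      rw [Pi.sub_apply, Pi.zero_apply, sub_eq_zero] at h5
      rwa [Sum.elim_inr, hd, Sum.elim_inr] at h5
    · unfold codeOfParameter
      refine sup_le (sup_le hF ?_) ?_
      · intro c hc
        obtain ⟨a, rfl⟩ := mem_eigenCode.1 hc
        rw [show ![a, t * a] = a • ![1, t] by ext b; fin_cases b <;> simp [mul_comm]]
        exact hC.traceWord_smul_mem hζ h1 a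
      · intro c hc
        obtain ⟨a, rfl⟩ := mem_eigenCode.1 hc
        rw [show ![a, -t⁻¹ * a] = a • ![1, -t⁻¹] by ext b; fin_cases b <;> simp [mul_comm]]
        exact hC.traceWord_smul_mem hζ.inv h2 a

end IsShiftInvariantExtremal

end Structure

/-! ### Dimensions of dual and self-orthogonal codes. -/

section Dual

variable {F : Type*} [Field F] {ι : Type*} [Fintype ι]

theorem finrank_add_finrank_dualCode (C : Submodule F (ι → F)) :
    Module.finrank F C + Module.finrank F (dualCode C) = Fintype.card ι := by
  classical
  have h : (dualCode C).map (dotProductEquiv F ι).toLinearMap = C.dualAnnihilator := by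
    ext φ
    rw [Submodule.mem_dualAnnihilator]
    constructor
    · rintro ⟨x, hx, rfl⟩ c hc
      exact hx c hc
    · intro hφ
      refine ⟨(dotProductEquiv F ι).symm φ, fun c hc => ?_, by simp⟩
      have := hφ c hc
      rw [← (dotProductEquiv F ι).apply_symm_apply φ] at this
      exact this
  have h1 := Subspace.finrank_add_finrank_dualAnnihilator_eq C
  have h2 : Module.finrank F ((dualCode C).map (dotProductEquiv F ι).toLinearMap) =
      Module.finrank F (dualCode C) := LinearEquiv.finrank_map_eq (dotProductEquiv F ι) _
  rw [← h2, h, h1, Module.finrank_fintype_fun_eq_card]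

/-- A self-orthogonal subspace of words supported on `S` has dimension at most half of `S.card`. -/
theorem two_mul_finrank_le_of_orthogonal (E : Submodule F (ι → F)) (S : Finset ι)
    (hS : ∀ x ∈ E, ∀ i ∉ S, x i = 0) (ho : ∀ x ∈ E, ∀ y ∈ E, ∑ i, x i * y i = 0) :
    2 * Module.finrank F E ≤ S.card := by
  let f : E →ₗ[F] (S → F) := LinearMap.funLeft F F (fun i : S => (i : ι)) ∘ₗ E.subtype
  have hf : Function.Injective f := by
    rw [injective_iff_map_eq_zero]
    rintro ⟨x, hx⟩ h
    ext i
    by_cases hi : i ∈ S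
    · exact congrFun h ⟨i, hi⟩
    · exact hS x hx i hi
  have h1 := finrank_add_finrank_dualCode (LinearMap.range f)
  have h2 : LinearMap.range f ≤ dualCode (LinearMap.range f) := by
    rintro _ ⟨⟨x, hx⟩, rfl⟩ _ ⟨⟨y, hy⟩, rfl⟩
    have h3 := ho x hx y hy
    rw [← Finset.sum_subset (Finset.subset_univ S)] at h3
    · rw [← h3]
      exact Finset.sum_coe_sort S fun i => x i * y i
    · intro i _ hi
      rw [hS x hx i hi, zero_mul]
  have h3 := Submodule.finrank_mono h2
  have h4 := LinearMap.finrank_range_of_inj hf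
  rw [Fintype.card_coe] at h1
  omega

end Dual

/-! ### Transport to standard coordinates and normalisation of the fixed code. -/

section Transfer

theorem IsShiftInvariantExtremal.of_isMonomial {ι : Type*} [Fintype ι]
    {C : Submodule (ZMod 3) (ι → ZMod 3)} {σ : (ι → ZMod 3) → (ι → ZMod 3)}
    (hσ : ∀ c ∈ C, σ c ∈ C) (ho : ∀ x ∈ C, ∀ y ∈ C, ∑ k, x k * y k = 0)
    (hd : Module.finrank (ZMod 3) C = 24) (hw : ∀ c ∈ C, c ≠ 0 → 15 ≤ hammingNorm c)
    {τ : (ι → ZMod 3) ≃ₗ[ZMod 3] (Coord → ZMod 3)} (hτ : IsMonomial τ)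
    (h : ∀ x, τ (σ x) = blockShift (τ x)) :
    IsShiftInvariantExtremal (C.map τ.toLinearMap) where
  shift := by
    rintro _ ⟨c, hc, rfl⟩
    exact ⟨σ c, hσ c hc, h c⟩
  orthogonal := by
    rintro _ ⟨x, hx, rfl⟩ _ ⟨y, hy, rfl⟩
    exact (sum_mul_eq_of_isMonomial hτ x y).trans (ho x hx y hy)
  finrank_eq := by rw [← hd]; exact LinearEquiv.finrank_map_eq τ C
  weight := by
    rintro _ ⟨c, hc, rfl⟩ h0
    rw [LinearEquiv.coe_coe, hammingNorm_eq_of_isMonomial hτ]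
    exact hw c hc (by rintro rfl; simp at h0)

theorem exists_isMonomial_standardFixedCode_le {C : Submodule (ZMod 3) (Coord → ZMod 3)}
    (hC : IsShiftInvariantExtremal C) {ζ : L} (hζ : IsPrimitiveRoot ζ 23) :
    ∃ m : (Coord → ZMod 3) ≃ₗ[ZMod 3] (Coord → ZMod 3), IsMonomial m ∧
      (∀ x, m (blockShift x) = blockShift (m x)) ∧ standardFixedCode ≤ C.map m.toLinearMap := by
  have hw : ∀ b : Fin 2, ∃ y : Fin 2 → ZMod 3,
      (Sum.elim (fun k => (Pi.single b 1 : Fin 2 → ZMod 3) k.1) y : Coord → ZMod 3) ∈ C := by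
    intro b
    obtain ⟨⟨c, hc⟩, h⟩ := hC.invariants_surjective hζ (Pi.single b 1, 0, 0)
    rw [IsShiftInvariantExtremal.invariants_apply, Prod.mk.injEq] at h
    refine ⟨fun b => c (Sum.inr b), ?_⟩
    rw [← h.1]
    exact hC.average_mem hc
  choose y hy using hw
  have ho : ∀ b b', 23 * (if b = b' then 1 else 0) + ∑ j, y b j * y b' j = 0 := by
    intro b b'
    have h := hC.orthogonal _ (hy b) _ (hy b')
    rw [Fintype.sum_sum_type, Fintype.sum_prod_type] at h
    simp only [Sum.elim_inl, Sum.elim_inr, Finset.sum_const, Finset.card_univ, ZMod.card] at h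
    refine Eq.trans ?_ h
    congr 1
    clear h
    fin_cases b <;> fin_cases b' <;> simp
  -- As 23 = -1, the check parts form an orthogonal 2×2 matrix. In 𝔽₃ a row with p² + q² = 1 has
  -- exactly one nonzero entry, so the matrix is monomial, and undoing it on the last two
  -- coordinates commutes with the shift.
  have key : ∀ p q r s : ZMod 3, 23 + (p * p + q * q) = 0 → 23 + (r * r + s * s) = 0 →
      p * r + q * s = 0 → (∃ u v : (ZMod 3)ˣ, p = u ∧ q = 0 ∧ r = 0 ∧ s = v) ∨
      ∃ u v : (ZMod 3)ˣ, p = 0 ∧ q = u ∧ r = v ∧ s = 0 := by decide +kernel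
  have h00 := ho 0 0
  have h11 := ho 1 1
  have h01 := ho 0 1
  simp only [Fin.sum_univ_two, if_true, mul_one, zero_ne_one, if_false, mul_zero,
    zero_add] at h00 h11 h01
  have hu : ∀ v : (ZMod 3)ˣ, (v : ZMod 3) * v = 1 := by decide
  have hmain : ∀ (e : Equiv.Perm (Fin 2)) (u : Fin 2 → (ZMod 3)ˣ),
      (∀ b j, (u j : ZMod 3) * y b (e.symm j) = (Pi.single b 1 : Fin 2 → ZMod 3) j) →
      ∃ m : (Coord → ZMod 3) ≃ₗ[ZMod 3] (Coord → ZMod 3), IsMonomial m ∧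
      (∀ x, m (blockShift x) = blockShift (m x)) ∧ standardFixedCode ≤ C.map m.toLinearMap := by
    intro e u h
    refine ⟨monomialEquiv (Equiv.sumCongr (Equiv.refl _) e) (Sum.elim (fun _ => 1) u),
      isMonomial_monomialEquiv _ _, fun x => ?_, ?_⟩
    · ext (⟨b, i⟩ | j) <;> simp
    · refine Submodule.span_le.2 ?_
      rintro _ ⟨b, rfl⟩
      refine ⟨_, hy b, ?_⟩
      ext (⟨d, i⟩ | j)
      · simp [Pi.single_apply]
      · simp [h, Pi.single_apply]
  rcases key _ _ _ _ h00 h11 h01 with ⟨u, v, h1, h2, h3, h4⟩ | ⟨u, v, h1, h2, h3, h4⟩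
  · refine hmain (Equiv.refl _) ![u, v] fun b j => ?_
    fin_cases b <;> fin_cases j <;> simp [h1, h2, h3, h4, hu]
  · refine hmain (Equiv.swap 0 1) ![u, v] fun b j => ?_
    fin_cases b <;> fin_cases j <;> simp [h1, h2, h3, h4, hu]

end Transfer

/-! ### Cycle structure of monomial maps whose 23rd power is the identity. -/

section Orbits

variable {ι : Type*}

theorem exists_pow_apply {F : Type*} [Field F] {f : (ι → F) ≃ₗ[F] (ι → F)} {π : Equiv.Perm ι}
    {u : ι → Fˣ} (h : ∀ x k, f x k = u k * x (π k)) (n : ℕ) :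
    ∃ U : ι → Fˣ, ∀ x k, (f ^ n) x k = U k * x ((π ^ n) k) := by
  induction n with
  | zero => exact ⟨fun _ => 1, fun x k => by simp⟩
  | succ n ih =>
    obtain ⟨U, hU⟩ := ih
    refine ⟨fun k => U k * u ((π ^ n) k), fun x k => ?_⟩
    rw [pow_succ, LinearEquiv.mul_apply, hU, h, pow_succ' π, Equiv.Perm.mul_apply, Units.val_mul,
      mul_assoc]

theorem pow_perm_eq_one {F : Type*} [Field F] {f : (ι → F) ≃ₗ[F] (ι → F)}
    {π : Equiv.Perm ι} {u : ι → Fˣ} (h : ∀ x k, f x k = u k * x (π k)) {n : ℕ} (hf : f ^ n = 1) :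
    π ^ n = 1 := by
  classical
  obtain ⟨U, hU⟩ := exists_pow_apply h n
  ext k
  have h1 := hU (Pi.single k 1) k
  rw [hf] at h1
  by_contra hne
  simp [show (π ^ n) k ≠ k from hne] at h1

theorem apply_eq_of_fixed {f : (ι → ZMod 3) ≃ₗ[ZMod 3] (ι → ZMod 3)} {π : Equiv.Perm ι}
    {u : ι → (ZMod 3)ˣ} (h : ∀ x k, f x k = u k * x (π k)) (hf : f ^ 23 = 1) {k : ι}
    (hk : π k = k) (x : ι → ZMod 3) : f x k = x k := by
  have h1 : ∀ (n : ℕ) (x : ι → ZMod 3), (f ^ n) x k = (u k : ZMod 3) ^ n * x k := by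
    intro n
    induction n with
    | zero => simp
    | succ n ih => intro x; rw [pow_succ, LinearEquiv.mul_apply, ih, h, hk, pow_succ, mul_assoc]
  have h2 := h1 23 fun _ => 1
  rw [hf] at h2
  -- The exponent is odd, so a sign at a fixed coordinate must be +1.
  have key : ∀ v : ZMod 3, 1 = v ^ 23 → v = 1 := by decide +kernel
  rw [h, hk, key (u k : ZMod 3) (by simpa using h2), one_mul]

theorem orbit_injective {π : Equiv.Perm ι} (hπ : π ^ 23 = 1) {p : ι} (hp : π p ≠ p) :
    Function.Injective fun i : ZMod 23 => (π ^ i.val) p := by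
  have hper : Function.IsPeriodicPt π 23 p := by
    change π^[23] p = p
    rw [Equiv.Perm.iterate_eq_pow, hπ]; rfl
  have hmin : Function.minimalPeriod π p = 23 := by
    rcases (Nat.dvd_prime (by norm_num : Nat.Prime 23)).1 hper.minimalPeriod_dvd with h | h
    · exact absurd (Function.minimalPeriod_eq_one_iff_isFixedPt.1 h) hp
    · exact h
  intro i j hij
  simp only [← Equiv.Perm.iterate_eq_pow] at hij
  exact ZMod.val_injective 23 (Function.iterate_injOn_Iio_minimalPeriod
    (by rw [hmin]; exact i.val_lt) (by rw [hmin]; exact j.val_lt) hij)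

theorem card_support_eq [Fintype ι] [DecidableEq ι] (hι : Fintype.card ι = 48)
    {π : Equiv.Perm ι} (hπ : π ^ 23 = 1) (h1 : π ≠ 1) :
    π.support.card = 23 ∨ π.support.card = 46 := by
  have : Fact (Nat.Prime 23) := ⟨by norm_num⟩
  have ho : orderOf π = 23 := orderOf_eq_prime hπ h1
  obtain ⟨n, hn⟩ := Equiv.Perm.cycleType_prime_order (σ := π) (by rw [ho]; norm_num)
  have hs := π.sum_cycleType
  have hle := π.sum_cycleType_le
  rw [hn, ho] at hs hle
  simp only [Multiset.sum_replicate, smul_eq_mul] at hs hle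
  have : n = 0 ∨ n = 1 := by omega
  rcases this with rfl | rfl <;> omega

/-- The coordinates can be labelled by two cycles and two fixed points. -/
theorem exists_coord_equiv [Fintype ι] [DecidableEq ι] (hι : Fintype.card ι = 48)
    {π : Equiv.Perm ι} (hπ : π ^ 23 = 1) (hs : π.support.card = 46) :
    ∃ (g : Coord ≃ ι) (p : Fin 2 → ι), (∀ b i, g (Sum.inl (b, i)) = (π ^ i.val) (p b)) ∧
      ∀ j, π (g (Sum.inr j)) = g (Sum.inr j) := by
  obtain ⟨p₀, hp₀⟩ : π.support.Nonempty := Finset.card_pos.1 (by omega)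
  have hi₀ := orbit_injective hπ (Equiv.Perm.mem_support.1 hp₀)
  obtain ⟨p₁, hp₁, hp₁'⟩ : ∃ p ∈ π.support, p ∉ Finset.univ.image
      (fun i : ZMod 23 => (π ^ i.val) p₀) := by
    by_contra! h
    have h1 := Finset.card_le_card h
    rw [Finset.card_image_of_injective _ hi₀, Finset.card_univ, ZMod.card] at h1
    omega
  have hi₁ := orbit_injective hπ (Equiv.Perm.mem_support.1 hp₁)
  have hcompl : (π.supportᶜ).card = 2 := by rw [Finset.card_compl]; omega
  let q : Fin 2 ≃ {x // x ∈ π.supportᶜ} := (Finset.equivFinOfCardEq hcompl).symm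
  have hq : ∀ j, (q j : ι) ∉ π.support := fun j => Finset.mem_compl.1 (q j).2
  have horb : ∀ (n : ℕ) (x : ι), x ∈ π.support → (π ^ n) x ∈ π.support := fun n x hx =>
    Equiv.Perm.pow_apply_mem_support.2 hx
  have hdisj : ∀ i j : ZMod 23, (π ^ i.val) p₀ ≠ (π ^ j.val) p₁ := by
    intro i j hij
    refine hp₁' (Finset.mem_image.2 ⟨-j + i, Finset.mem_univ _, ?_⟩)
    rw [pow_val_add hπ, Equiv.Perm.mul_apply, hij, ← Equiv.Perm.mul_apply, ← pow_val_add hπ,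
      neg_add_cancel]
    simp
  let g : Coord → ι := Sum.elim (fun k => (π ^ k.2.val) (![p₀, p₁] k.1)) fun j => q j
  have hp : ∀ b, ![p₀, p₁] b ∈ π.support := fun b => by fin_cases b <;> assumption
  have hg : Function.Injective g := by
    rintro (⟨b, i⟩ | j) (⟨b', i'⟩ | j') h
    · simp only [g, Sum.elim_inl] at h
      have hb : b = b' := by
        fin_cases b <;> fin_cases b'
        · rfl
        · exact absurd h (hdisj i i')
        · exact absurd h.symm (hdisj i' i)
        · rfl
      subst hb
      have hii : i = i' := by
        fin_cases b
        · exact hi₀ h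
        · exact hi₁ h
      rw [hii]
    · have h1 : (π ^ i.val) (![p₀, p₁] b) = q j' := h
      exact absurd (h1 ▸ horb _ _ (hp b)) (hq j')
    · have h1 : (π ^ i'.val) (![p₀, p₁] b') = q j := h.symm
      exact absurd (h1 ▸ horb _ _ (hp b')) (hq j)
    · exact congrArg Sum.inr (q.injective (Subtype.ext h))
  have hbij : Function.Bijective g := by
    rw [Fintype.bijective_iff_injective_and_card]
    exact ⟨hg, by rw [hι]; rfl⟩
  exact ⟨Equiv.ofBijective g hbij, ![p₀, p₁], fun b i => rfl, fun j =>
    Equiv.Perm.notMem_support.1 (hq j)⟩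

end Orbits

/-! ### An automorphism of order 23 is conjugate to the block shift. -/

section Automorphism

variable {ι : Type*} [Fintype ι] {C : Submodule (ZMod 3) (ι → ZMod 3)}
  {f : (ι → ZMod 3) ≃ₗ[ZMod 3] (ι → ZMod 3)} {π : Equiv.Perm ι} {u : ι → (ZMod 3)ˣ}

/-- An automorphism of order 23 of a code with these parameters has more than one cycle. -/
theorem card_support_ne [DecidableEq ι] (hι : Fintype.card ι = 48)
    (ho : ∀ x ∈ C, ∀ y ∈ C, ∑ k, x k * y k = 0) (hd : Module.finrank (ZMod 3) C = 24)
    (hw : ∀ c ∈ C, c ≠ 0 → 15 ≤ hammingNorm c)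
    (h : ∀ x k, f x k = u k * x (π k)) (hf : f ^ 23 = 1) (hfC : ∀ c ∈ C, f c ∈ C) :
    π.support.card ≠ 23 := by
  intro hs
  let φ : C →ₗ[ZMod 3] (ι → ZMod 3) := (f.toLinearMap - LinearMap.id) ∘ₗ C.subtype
  have hφ : ∀ c : C, φ c = f c - c := fun c => rfl
  have hφC : LinearMap.range φ ≤ C := by
    rintro _ ⟨c, rfl⟩
    exact C.sub_mem (hfC c c.2) c.2
  -- The image of f - 1 is a self-orthogonal code supported on the single 23-cycle, so its dimension
  -- is at most 11 and the fixed code has dimension at least 13.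
  have h1 : 2 * Module.finrank (ZMod 3) (LinearMap.range φ) ≤ π.support.card := by
    refine two_mul_finrank_le_of_orthogonal _ _ ?_ fun x hx y hy => ho x (hφC hx) y (hφC hy)
    rintro _ ⟨c, rfl⟩ i hi
    rw [hφ, Pi.sub_apply, apply_eq_of_fixed h hf (Equiv.Perm.notMem_support.1 hi), sub_self]
  have h2 := LinearMap.finrank_range_add_finrank_ker φ
  have h3 := Submodule.finrank_map_subtype_eq C (LinearMap.ker φ)
  obtain ⟨p, hp⟩ : π.support.Nonempty := Finset.card_pos.1 (by omega)
  have hcompl : π.supportᶜ.card = 25 := by rw [Finset.card_compl]; omega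
  obtain ⟨A, hA, hA'⟩ := Finset.exists_subset_card_eq (s := π.supportᶜ) (n := 11) (by omega)
  -- Twelve conditions: a fixed word vanishing at p vanishes on the whole cycle, and 11 of the other
  -- 25 coordinates are also killed, leaving weight at most 14.
  obtain ⟨w, hwD, hw0, hwT⟩ := exists_ne_zero_vanishing
    ((LinearMap.ker φ).map C.subtype) (insert p A)
    (lt_of_le_of_lt (Finset.card_insert_le p A) (by omega))
  obtain ⟨⟨c, hc⟩, hck, rfl⟩ := hwD
  change c ≠ 0 at hw0
  change ∀ i ∈ insert p A, c i = 0 at hwT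
  have hfc : f c = c := sub_eq_zero.1 (LinearMap.mem_ker.1 hck)
  have hfn : ∀ n : ℕ, (f ^ n) c = c := by
    intro n
    induction n with
    | zero => rfl
    | succ n ih => rw [pow_succ, LinearEquiv.mul_apply, hfc, ih]
  have horb : Finset.univ.image (fun i : ZMod 23 => (π ^ i.val) p) = π.support := by
    refine Finset.eq_of_subset_of_card_le ?_ ?_
    · intro x hx
      obtain ⟨i, -, rfl⟩ := Finset.mem_image.1 hx
      exact Equiv.Perm.pow_apply_mem_support.2 hp
    · rw [Finset.card_image_of_injective _ (orbit_injective (pow_perm_eq_one h hf)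
        (Equiv.Perm.mem_support.1 hp)), hs, Finset.card_univ, ZMod.card]
  have hle : hammingNorm c ≤ (π.supportᶜ \ A).card := by
    refine hammingNorm_le_of_vanishing fun i hi => ?_
    by_cases hiA : i ∈ A
    · exact hwT i (Finset.mem_insert_of_mem hiA)
    have hiS : i ∈ π.support := by
      by_contra hiS
      exact hi (Finset.mem_sdiff.2 ⟨Finset.mem_compl.2 hiS, hiA⟩)
    rw [← horb] at hiS
    obtain ⟨n, -, rfl⟩ := Finset.mem_image.1 hiS
    obtain ⟨U, hU⟩ := exists_pow_apply h n.val
    have h4 := hU c p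
    rw [hfn, hwT p (Finset.mem_insert_self _ _)] at h4
    simpa using h4.symm
  rw [Finset.card_sdiff_of_subset hA, hcompl, hA'] at hle
  have := hw c hc hw0
  omega

/-- A monomial map with two cycles of length 23 and two fixed points is conjugate to the shift. -/
theorem exists_isMonomial_conj [DecidableEq ι] (hι : Fintype.card ι = 48)
    (h : ∀ x k, f x k = u k * x (π k)) (hf : f ^ 23 = 1) (hs : π.support.card = 46) :
    ∃ τ : (ι → ZMod 3) ≃ₗ[ZMod 3] (Coord → ZMod 3), IsMonomial τ ∧
      ∀ x, τ (f⁻¹ x) = blockShift (τ x) := by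
  obtain ⟨g, p, hg, hg'⟩ := exists_coord_equiv hι (pow_perm_eq_one h hf) hs
  choose U hU using exists_pow_apply h
  -- The coordinate (b, i) reads off (f^i x)(p b), so the signs along a cycle are absorbed; f^23 = 1
  -- makes this consistent modulo 23.
  let τ := monomialEquiv (F := ZMod 3) g.symm
    (Sum.elim (fun k => U k.2.val (p k.1)) fun _ => 1)
  have hl : ∀ x b i, τ x (Sum.inl (b, i)) = (f ^ i.val) x (p b) := fun x b i => by
    simp [τ, hU, hg]
  have hr : ∀ x j, τ x (Sum.inr j) = x (g (Sum.inr j)) := fun x j => by simp [τ]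
  have hff : ∀ x, f (f⁻¹ x) = x := f.apply_symm_apply
  refine ⟨τ, isMonomial_monomialEquiv _ _, fun x => ?_⟩
  ext (⟨b, i⟩ | j)
  · rw [blockShift_inl, hl, hl]
    have h1 : f ^ i.val = f ^ (i - 1).val * f := by
      have h2 := pow_val_add hf (i - 1) 1
      rw [sub_add_cancel] at h2
      rw [h2, ZMod.val_one'' (by norm_num), pow_one]
    rw [h1, LinearEquiv.mul_apply, hff]
  · rw [blockShift_inr, hr, hr, ← apply_eq_of_fixed h hf (hg' j) (f⁻¹ x), hff]

end Automorphism

/-- The classification of the extremal self-dual codes of length 48 with an automorphism of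
order 23. -/
theorem exists_isMonomial_codeOfParameter {ι : Type*} [Fintype ι] [DecidableEq ι]
    (hι : Fintype.card ι = 48) {ζ : L} (hζ : IsPrimitiveRoot ζ 23)
    {C : Submodule (ZMod 3) (ι → ZMod 3)} {σ : (ι → ZMod 3) ≃ₗ[ZMod 3] (ι → ZMod 3)}
    (hC : IsExtremalSelfDual C) (hσ : σ ∈ Mon C) (hord : orderOf σ = 23) :
    ∃ τ : (ι → ZMod 3) ≃ₗ[ZMod 3] (Coord → ZMod 3), IsMonomial τ ∧
      (∀ x, τ (σ x) = blockShift (τ x)) ∧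
      fixedCode blockShift (C.map τ.toLinearMap) = standardFixedCode ∧
      ∃ t : L, t ≠ 0 ∧ C.map τ.toLinearMap = codeOfParameter ζ t := by
  obtain ⟨hdual, hdist⟩ := hC
  rw [hι] at hdist
  have ho : ∀ x ∈ C, ∀ y ∈ C, ∑ k, x k * y k = 0 := by
    intro x hx y hy
    rw [hdual] at hx
    exact hx y hy
  have hd : Module.finrank (ZMod 3) C = 24 := by
    have := finrank_add_finrank_dualCode C
    rw [← hdual, hι] at this
    omega
  have hw : ∀ c ∈ C, c ≠ 0 → 15 ≤ hammingNorm c := fun c hc h0 =>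
    le_hammingNorm_of_le_minDist (by rw [hdist]) hc h0
  have hmap : ∀ f ∈ Mon C, ∀ c ∈ C, f c ∈ C := by
    rintro f ⟨-, hf⟩ c hc
    rw [← hf]
    exact ⟨c, hc, rfl⟩
  -- The conjugation lemma turns the inverse of its map into the shift, so it is applied to σ⁻¹.
  have hσ' := (Mon C).inv_mem hσ
  have hpow : σ⁻¹ ^ 23 = 1 := by rw [inv_pow, ← hord, pow_orderOf_eq_one, inv_one]
  obtain ⟨⟨e, u, h⟩, -⟩ := hσ'
  have h1 : e.symm ≠ 1 := by
    intro he
    have : σ⁻¹ = 1 := by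
      ext x k
      exact apply_eq_of_fixed h hpow (by rw [he]; rfl) x
    rw [inv_eq_one.1 this, orderOf_one] at hord
    omega
  have hs : (Equiv.Perm.support e.symm).card = 46 :=
    (card_support_eq hι (pow_perm_eq_one h hpow) h1).resolve_left
      (card_support_ne hι ho hd hw h hpow (hmap _ ((Mon C).inv_mem hσ)))
  obtain ⟨τ, hτ, hconj⟩ := exists_isMonomial_conj hι h hpow hs
  rw [inv_inv] at hconj
  have hS := IsShiftInvariantExtremal.of_isMonomial (hmap σ hσ) ho hd hw hτ hconj
  obtain ⟨m, hm, hmconj, hle⟩ := exists_isMonomial_standardFixedCode_le hS hζ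
  have hτm : IsMonomial (τ.trans m) := hτ.trans hm
  have hconj' : ∀ x, (τ.trans m) (σ x) = blockShift ((τ.trans m) x) := fun x => by
    rw [LinearEquiv.trans_apply, hconj, hmconj, LinearEquiv.trans_apply]
  refine ⟨τ.trans m, hτm, hconj', ?_⟩
  refine (IsShiftInvariantExtremal.of_isMonomial (hmap σ hσ) ho hd hw hτm hconj'
    ).exists_eq_codeOfParameter hζ ?_
  refine hle.trans (le_of_eq ?_)
  rw [← Submodule.map_comp]
  rfl

end TernaryCodes

theorem mainTheorem4
    (α : AlgebraicClosure (ZMod 3)) (hα : IsPrimitiveRoot α 47)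
    (ζ : GaloisField 3 11) (hζ : IsPrimitiveRoot ζ 23) :
    (∀ (C : Submodule (ZMod 3) (Fin 48 → ZMod 3))
        (σ : (Fin 48 → ZMod 3) ≃ₗ[ZMod 3] (Fin 48 → ZMod 3)),
      TernaryCodes.IsExtremalSelfDual C → σ ∈ TernaryCodes.Mon C → orderOf σ = 23 →
        (TernaryCodes.CodeEquiv C TernaryCodes.P48 ∨
          TernaryCodes.CodeEquiv C (TernaryCodes.Q48 α)) ∧
        ∃ τ : (Fin 48 → ZMod 3) ≃ₗ[ZMod 3] (TernaryCodes.Coord → ZMod 3),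
          TernaryCodes.IsMonomial τ ∧
          (∀ x, τ (σ x) = TernaryCodes.blockShift (τ x)) ∧
          TernaryCodes.fixedCode TernaryCodes.blockShift (C.map τ.toLinearMap) =
            TernaryCodes.standardFixedCode ∧
          ∃ t : GaloisField 3 11, t ≠ 0 ∧
            TernaryCodes.eigenComponent TernaryCodes.blockShift (C.map τ.toLinearMap)
              (minpoly (ZMod 3) ζ) = TernaryCodes.eigenCode ζ t ∧
            TernaryCodes.eigenComponent TernaryCodes.blockShift (C.map τ.toLinearMap)
              (minpoly (ZMod 3) ζ⁻¹) = TernaryCodes.eigenCode ζ⁻¹ (-t⁻¹) ∧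
            C.map τ.toLinearMap = TernaryCodes.codeOfParameter ζ t) ∧
    (∀ t : GaloisField 3 11, t ≠ 0 →
      (∀ η : GaloisField 3 11, η ^ 23 = 1 →
        TernaryCodes.CodeEquiv (TernaryCodes.codeOfParameter ζ (η * t))
          (TernaryCodes.codeOfParameter ζ t)) ∧
      (15 ≤ TernaryCodes.minDist (TernaryCodes.codeOfParameter ζ t) →
        TernaryCodes.CodeEquiv (TernaryCodes.codeOfParameter ζ t) TernaryCodes.P48 ∨
        TernaryCodes.CodeEquiv (TernaryCodes.codeOfParameter ζ t) (TernaryCodes.Q48 α))) := by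
  have hP : ∀ t : GaloisField 3 11, t ≠ 0 →
      (∀ c ∈ TernaryCodes.codeOfParameter ζ t, c ≠ 0 → 15 ≤ hammingNorm c) →
      TernaryCodes.CodeEquiv (TernaryCodes.codeOfParameter ζ t) TernaryCodes.P48 ∨
        TernaryCodes.CodeEquiv (TernaryCodes.codeOfParameter ζ t) (TernaryCodes.Q48 α) :=
    fun t ht hw => TernaryCodes.codeEquiv_P48_or_Q48 hα hζ ht hw
  refine ⟨fun C σ hC hσ hord => ?_, fun t ht => ⟨fun η hη => ?_, fun hd => ?_⟩⟩
  · obtain ⟨τ, hτ, hconj, hF, t, ht, hCt⟩ :=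
      TernaryCodes.exists_isMonomial_codeOfParameter (by simp) hζ hC hσ hord
    have hE : TernaryCodes.CodeEquiv C (TernaryCodes.codeOfParameter ζ t) := ⟨τ, hτ, hCt⟩
    refine ⟨?_, τ, hτ, hconj, hF, t, ht, ?_, ?_, hCt⟩
    · have hw : ∀ c ∈ TernaryCodes.codeOfParameter ζ t, c ≠ 0 → 15 ≤ hammingNorm c := by
        rw [← hCt]
        rintro _ ⟨c, hc, rfl⟩ h0
        rw [LinearEquiv.coe_coe, TernaryCodes.hammingNorm_eq_of_isMonomial hτ]
        exact TernaryCodes.le_hammingNorm_of_le_minDist (by rw [hC.2]; simp) hc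
          (by rintro rfl; simp at h0)
      exact (hP t ht hw).imp hE.trans hE.trans
    · rw [hCt]
      exact TernaryCodes.eigenComponent_codeOfParameter hζ t
    · have h := TernaryCodes.eigenComponent_codeOfParameter hζ.inv (-t⁻¹)
      rwa [TernaryCodes.codeOfParameter_inv, ← hCt] at h
  · exact (TernaryCodes.codeEquiv_mul_root hζ hη t).symm
  · exact hP t ht fun c hc h0 => TernaryCodes.le_hammingNorm_of_le_minDist hd hc h0
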